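/- Let $C_{70}$ be the smooth projective genus-$2$ curve over $\mathbb{Q}$ with affine equation $$y^2 + (2x^3-3x^2-41x+110)\,y = x^3-51x^2+425x+179,$$ and let $J$ be its Jacobian. Then the group $J(\mathbb{Q})$ of rational points of $J$, that is, the group of divisor classes of degree $0$ on $C_{70}$ over $\overline{\mathbb{Q}}$ that are fixed by $\mathrm{Gal}(\overline{\mathbb{Q}}/\mathbb{Q})$, contains an element of order exactly $70$. Moreover, $C_{70}$ has exactly two points at infinity $P_1 \neq P_2$, and the class of the divisor $(2,17)+(4,23)-P_1-P_2$ is such an element. -/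

import Mathlib

/-! ## Places, divisors and divisor classes of a function field -/

/-- A place of a field `F` over a subfield `k`: a discrete valuation of `F`, normalised to have
value group exactly `ℤ`, that is trivial on `k`. If `F` is the function field of a smooth projective
curve over `k`, the places of `F` over `k` are in bijection with the closed points of the curve. -/
structure Place (k F : Type*) [Field k] [Field F] [Algebra k F] where
  /-- The underlying valuation, written multiplicatively. -/
  val : Valuation F (WithZero (Multiplicative ℤ))
  surjective : Function.Surjective val
  trivial : ∀ c : k, c ≠ 0 → val (algebraMap k F c) = 1

namespace Place

variable {k F : Type*} [Field k] [Field F] [Algebra k F]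

theorem ext_val {v w : Place k F} (h : ∀ g, v.val g = w.val g) : v = w := by
  obtain ⟨v, _, _⟩ := v
  obtain ⟨w, _, _⟩ := w
  obtain rfl : v = w := Valuation.ext h
  rfl

/-- The order of vanishing of a function at a place (positive at zeros, negative at poles; the value
at the zero function is irrelevant). -/
noncomputable def ord (v : Place k F) (g : F) : ℤ := -WithZero.log (v.val g)

theorem ord_one (v : Place k F) : v.ord 1 = 0 := by simp [ord]

theorem ord_mul (v : Place k F) {f g : F} (hf : f ≠ 0) (hg : g ≠ 0) :
    v.ord (f * g) = v.ord f + v.ord g := by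
  rw [ord, map_mul, WithZero.log_mul ((Valuation.ne_zero_iff _).2 hf)
    ((Valuation.ne_zero_iff _).2 hg), ord, ord]
  ring

theorem ord_inv (v : Place k F) (f : F) : v.ord f⁻¹ = -v.ord f := by
  simp [ord, WithZero.log_inv]

/-- Transport of a place along an automorphism `φ` of the field that maps the constants onto the
constants by `τ`: the function `φ g` has at the new place the order that `g` has at the old one. -/
def transport (φ : F ≃+* F) (τ : k ≃+* k)
    (hφ : ∀ c, φ (algebraMap k F c) = algebraMap k F (τ c)) (v : Place k F) : Place k F where
  val := v.val.comap (φ.symm : F →+* F)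
  surjective := fun t => by
    obtain ⟨g, hg⟩ := v.surjective t
    exact ⟨φ g, by simpa using hg⟩
  trivial := fun c hc => by
    have h : φ.symm (algebraMap k F c) = algebraMap k F (τ.symm c) := by
      rw [RingEquiv.symm_apply_eq, hφ, RingEquiv.apply_symm_apply]
    have h0 : τ.symm c ≠ 0 := by simpa using hc
    simpa [h] using v.trivial _ h0

/-- `Place.transport` as a permutation of the places. -/
def transportEquiv (φ : F ≃+* F) (τ : k ≃+* k)
    (hφ : ∀ c, φ (algebraMap k F c) = algebraMap k F (τ c)) : Place k F ≃ Place k F where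
  toFun := transport φ τ hφ
  invFun := transport φ.symm τ.symm fun c => by
    rw [RingEquiv.symm_apply_eq, hφ, RingEquiv.apply_symm_apply]
  left_inv v := ext_val fun g => by simp [transport]
  right_inv v := ext_val fun g => by simp [transport]

theorem ord_transportEquiv_symm (φ : F ≃+* F) (τ : k ≃+* k)
    (hφ : ∀ c, φ (algebraMap k F c) = algebraMap k F (τ c)) (v : Place k F) (g : F) :
    ((transportEquiv φ τ hφ).symm v).ord g = v.ord (φ g) := by
  simp [transportEquiv, transport, ord]

end Place

/-- Divisors: finite formal sums of places with integer coefficients. -/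
abbrev Divisor (k F : Type*) [Field k] [Field F] [Algebra k F] := Place k F →₀ ℤ

namespace Divisor

variable (k F : Type*) [Field k] [Field F] [Algebra k F]

/-- The degree of a divisor when the field of constants `k` is algebraically closed, so that every
place has degree one. -/
noncomputable def degree [IsAlgClosed k] : Divisor k F →+ ℤ :=
  Finsupp.liftAddHom fun _ => AddMonoidHom.id ℤ

/-- The group of principal divisors, that is, the divisors of nonzero functions. -/
def principal : AddSubgroup (Divisor k F) where
  carrier := {D | ∃ g : F, g ≠ 0 ∧ ∀ v : Place k F, D v = v.ord g}
  zero_mem' := ⟨1, one_ne_zero, fun v => by simp [Place.ord_one]⟩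
  add_mem' := by
    rintro D E ⟨f, hf, hD⟩ ⟨g, hg, hE⟩
    exact ⟨f * g, mul_ne_zero hf hg, fun v => by simp [hD, hE, v.ord_mul hf hg]⟩
  neg_mem' := by
    rintro D ⟨f, hf, hD⟩
    exact ⟨f⁻¹, inv_ne_zero hf, fun v => by simp [hD, v.ord_inv]⟩

/-- The divisor class group: divisors modulo linear equivalence. -/
abbrev ClassGroup := Divisor k F ⧸ principal k F

/-- The group `Pic⁰` of divisor classes of degree zero, over an algebraically closed field. -/
noncomputable def picZero [IsAlgClosed k] : AddSubgroup (ClassGroup k F) :=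
  (degree k F).ker.map (QuotientAddGroup.mk' (principal k F))

variable {k F}

/-- The action on divisor classes of a field automorphism that maps constants onto constants. -/
noncomputable def classMap (φ : F ≃+* F) (τ : k ≃+* k)
    (hφ : ∀ c, φ (algebraMap k F c) = algebraMap k F (τ c)) :
    ClassGroup k F →+ ClassGroup k F :=
  QuotientAddGroup.map (principal k F) (principal k F)
    (Finsupp.domCongr (Place.transportEquiv φ τ hφ) : Divisor k F ≃+ Divisor k F).toAddMonoidHom
    (by
      rintro D ⟨g, hg, hD⟩
      refine ⟨φ g, by simpa using hg, fun v => ?_⟩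
      simp [Finsupp.domCongr_apply, Finsupp.equivMapDomain_apply, hD,
        Place.ord_transportEquiv_symm])

end Divisor

/-! ## Curves of genus two -/

open Polynomial in
/-- A genus-2 curve over a field `K`, given by an equation `y² + h(x) y = f(x)` with `deg h ≤ 3` and
`deg f ≤ 6` whose projective model (in the weighted projective plane with weights 1, 3, 1) is smooth.
The model is covered by the affine `(x, y)`-chart and by the chart with the coordinates `z = 1 / x`,
`w = y / x³`, in which the equation is `w² + (h₃ + h₂ z + ⋯) w = f₆ + f₅ z + ⋯` and the points at
infinity are those with `z = 0`. Smoothness is the Jacobian criterion, at all points over an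
algebraic closure. -/
structure GenusTwoCurve (K : Type*) [Field K] where
  h : K[X]
  f : K[X]
  natDegree_h_le : h.natDegree ≤ 3
  natDegree_f_le : f.natDegree ≤ 6
  smooth_affine : ∀ x y : AlgebraicClosure K,
    y ^ 2 + aeval x h * y = aeval x f →
    ¬ (2 * y + aeval x h = 0 ∧ aeval x (derivative h) * y = aeval x (derivative f))
  smooth_infinity : ∀ w : AlgebraicClosure K,
    w ^ 2 + algebraMap K _ (h.coeff 3) * w = algebraMap K _ (f.coeff 6) →
    ¬ (2 * w + algebraMap K _ (h.coeff 3) = 0 ∧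
      algebraMap K _ (h.coeff 2) * w = algebraMap K _ (f.coeff 5))

namespace GenusTwoCurve

open Polynomial

variable {K : Type*} [Field K] (H : GenusTwoCurve K)

/-- The polynomial `Y² + h(X) Y - f(X)` over the algebraic closure of `K`, as a polynomial in `Y`
over the polynomial ring in `X`. -/
noncomputable def equation : (AlgebraicClosure K)[X][X] :=
  X ^ 2 + C (H.h.map (algebraMap K (AlgebraicClosure K))) * X
    - C (H.f.map (algebraMap K (AlgebraicClosure K)))

theorem equation_eq_cubic : H.equation = Cubic.toPoly
    ⟨0, 1, H.h.map (algebraMap K (AlgebraicClosure K)),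
      -H.f.map (algebraMap K (AlgebraicClosure K))⟩ := by
  simp only [equation, Cubic.toPoly, map_zero, map_one, map_neg]
  ring

/-- The curve is geometrically irreducible. -/
theorem irreducible_equation : Irreducible H.equation := by
  by_contra hred
  have hm : H.equation.Monic := by
    rw [equation_eq_cubic]; exact Cubic.monic_of_b_eq_one'
  have hd : H.equation.natDegree = 2 := by
    rw [equation_eq_cubic]; exact Cubic.natDegree_of_b_ne_zero' one_ne_zero
  obtain ⟨a, b, h0, h1⟩ := (hm.not_irreducible_iff_exists_add_mul_eq_coeff hd).1 hred
  rw [equation_eq_cubic] at h0 h1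
  simp only [Cubic.coeff_eq_c, Cubic.coeff_eq_d] at h0 h1
  have hfab : H.f.map (algebraMap K (AlgebraicClosure K)) = -(a * b) := by
    rw [← h0, neg_neg]
  have hh : ∀ x, aeval x H.h = a.eval x + b.eval x := fun x => by
    rw [← eval_map_algebraMap, h1, eval_add]
  have hf : ∀ x, aeval x H.f = -(a.eval x * b.eval x) := fun x => by
    rw [← eval_map_algebraMap, hfab, eval_neg, eval_mul]
  have hh' : ∀ x, aeval x (derivative H.h) = a.derivative.eval x + b.derivative.eval x :=
    fun x => by
      rw [← eval_map_algebraMap, ← derivative_map, h1, derivative_add, eval_add]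
  have hf' : ∀ x, aeval x (derivative H.f) =
      -(a.derivative.eval x * b.eval x + a.eval x * b.derivative.eval x) := fun x => by
    rw [← eval_map_algebraMap, ← derivative_map, hfab, derivative_neg, derivative_mul, eval_neg,
      eval_add, eval_mul, eval_mul]
  have hdsum : (a + b).natDegree ≤ 3 := by
    rw [← h1]; exact natDegree_map_le.trans H.natDegree_h_le
  have hdprod : (a * b).natDegree ≤ 6 := by
    rw [← natDegree_neg, ← hfab]; exact natDegree_map_le.trans H.natDegree_f_le
  by_cases hroot : ∃ x, (a - b).eval x = 0
  · obtain ⟨x, hx⟩ := hroot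
    rw [eval_sub, sub_eq_zero] at hx
    refine H.smooth_affine x (-b.eval x) ?_ ⟨?_, ?_⟩
    · rw [hh, hf]; ring
    · rw [hh, hx]; ring
    · rw [hh', hf', hx]; ring
  · have hconst : (a - b).degree = 0 := by
      by_contra hne
      exact hroot (IsAlgClosed.exists_root _ hne)
    have hcoeff : ∀ n, n ≠ 0 → a.coeff n = b.coeff n := fun n hn => by
      have h := eq_C_of_degree_eq_zero hconst
      have h2 : (a - b).coeff n = 0 := by rw [h, coeff_C, if_neg hn]
      rwa [coeff_sub, sub_eq_zero] at h2
    have hab : a.natDegree ≤ 3 ∧ b.natDegree ≤ 3 := by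
      by_cases hlt : 3 < a.natDegree ∨ 3 < b.natDegree
      · exfalso
        have heq : a.natDegree = b.natDegree := by
          rcases hlt with hlt | hlt
          · have ha0 : a ≠ 0 := by rintro rfl; simp at hlt
            have h3 : b.coeff a.natDegree ≠ 0 := by
              rw [← hcoeff _ (by omega)]; simpa using ha0
            refine le_antisymm (le_natDegree_of_ne_zero h3) ?_
            by_contra hgt
            push Not at hgt
            have h4 := hcoeff b.natDegree (by omega)
            rw [coeff_eq_zero_of_natDegree_lt hgt] at h4
            have hb0 : b ≠ 0 := by rintro rfl; simp at hgt
            exact hb0 (leadingCoeff_eq_zero.1 h4.symm)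
          · have hb0 : b ≠ 0 := by rintro rfl; simp at hlt
            have h3 : a.coeff b.natDegree ≠ 0 := by
              rw [hcoeff _ (by omega)]; simpa using hb0
            refine le_antisymm ?_ (le_natDegree_of_ne_zero h3)
            by_contra hgt
            push Not at hgt
            have h4 := hcoeff a.natDegree (by omega)
            rw [coeff_eq_zero_of_natDegree_lt hgt] at h4
            have ha0 : a ≠ 0 := by rintro rfl; simp at hgt
            exact ha0 (leadingCoeff_eq_zero.1 h4)
        have ha0 : a ≠ 0 := by rintro rfl; simp at hlt heq; omega
        have hb0 : b ≠ 0 := by rintro rfl; simp at hlt heq; omega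
        rw [natDegree_mul ha0 hb0] at hdprod
        omega
      · push Not at hlt; exact hlt
    have hc : ∀ n, algebraMap K (AlgebraicClosure K) (H.h.coeff n) = a.coeff n + b.coeff n :=
      fun n => by rw [← coeff_map, h1, coeff_add]
    have ha : ∀ n, 3 < n → a.coeff n = 0 := fun n hn =>
      coeff_eq_zero_of_natDegree_lt (lt_of_le_of_lt hab.1 hn)
    have hb : ∀ n, 3 < n → b.coeff n = 0 := fun n hn =>
      coeff_eq_zero_of_natDegree_lt (lt_of_le_of_lt hab.2 hn)
    have hc6 : algebraMap K (AlgebraicClosure K) (H.f.coeff 6) = -(a.coeff 3 * b.coeff 3) := by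
      rw [← coeff_map, hfab, coeff_neg, coeff_mul]
      simp [Finset.Nat.antidiagonal_succ, ha, hb]
    have hc5 : algebraMap K (AlgebraicClosure K) (H.f.coeff 5) =
        -(a.coeff 2 * b.coeff 3 + a.coeff 3 * b.coeff 2) := by
      rw [← coeff_map, hfab, coeff_neg, coeff_mul]
      simp [Finset.Nat.antidiagonal_succ, ha, hb]
    refine H.smooth_infinity (-b.coeff 3) ?_ ⟨?_, ?_⟩
    · rw [hc, hc6]; ring
    · rw [hc, hcoeff 3 (by norm_num)]; ring
    · rw [hc, hc5, hcoeff 3 (by norm_num)]; ring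

/-- The coordinate ring of the affine `(x, y)`-chart over the algebraic closure of `K`. -/
abbrev CoordinateRing : Type _ := AdjoinRoot H.equation

instance isDomain_coordinateRing : IsDomain H.CoordinateRing :=
  AdjoinRoot.isDomain_of_prime H.irreducible_equation.prime

/-- The function field of the curve over the algebraic closure of `K`. -/
abbrev FunctionField : Type _ := FractionRing H.CoordinateRing

/-- The coordinate function `x`. -/
noncomputable def x : H.FunctionField :=
  algebraMap H.CoordinateRing H.FunctionField (AdjoinRoot.of H.equation X)

/-- The coordinate function `y`. -/
noncomputable def y : H.FunctionField :=
  algebraMap H.CoordinateRing H.FunctionField (AdjoinRoot.root H.equation)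

/-- The points of the smooth projective curve over the algebraic closure of `K`. -/
abbrev Point : Type _ := Place (AlgebraicClosure K) H.FunctionField

/-- The point `P` is the affine point with the coordinates `(a, b)`: the functions `x - a` and
`y - b` vanish there. -/
def IsAffinePoint (P : H.Point) (a b : AlgebraicClosure K) : Prop :=
  P.val (H.x - algebraMap (AlgebraicClosure K) H.FunctionField a) < 1 ∧
    P.val (H.y - algebraMap (AlgebraicClosure K) H.FunctionField b) < 1

/-- The point `P` lies at infinity: the function `x` has a pole there. -/
def IsAtInfinity (P : H.Point) : Prop := 1 < P.val H.x

/-- The action of an automorphism `σ` of the algebraic closure over `K` on the coordinate ring,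
through the coefficients. -/
noncomputable def galoisCoordinateRing (σ : AlgebraicClosure K ≃ₐ[K] AlgebraicClosure K) :
    H.CoordinateRing ≃+* H.CoordinateRing :=
  AdjoinRoot.mapRingEquiv (Polynomial.mapEquiv σ.toRingEquiv) H.equation H.equation (by
    have hc : (σ.toRingEquiv : AlgebraicClosure K →+* AlgebraicClosure K).comp
        (algebraMap K (AlgebraicClosure K)) = algebraMap K (AlgebraicClosure K) :=
      RingHom.ext fun c => σ.commutes c
    have hp : ∀ p : K[X], Polynomial.mapEquiv σ.toRingEquiv
        (p.map (algebraMap K (AlgebraicClosure K))) =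
          p.map (algebraMap K (AlgebraicClosure K)) := fun p => by
      rw [Polynomial.mapEquiv_apply, Polynomial.map_map, hc]
    have he : H.equation.map
        (Polynomial.mapEquiv σ.toRingEquiv : _ →+* (AlgebraicClosure K)[X]) = H.equation := by
      simp only [equation, Polynomial.map_sub, Polynomial.map_add, Polynomial.map_mul,
        Polynomial.map_pow, Polynomial.map_X, Polynomial.map_C, RingHom.coe_coe, hp]
    rw [he])

/-- The action of an automorphism `σ` of the algebraic closure over `K` on the function field,
through the coefficients; it fixes `x` and `y`. -/
noncomputable def galoisFunctionField (σ : AlgebraicClosure K ≃ₐ[K] AlgebraicClosure K) :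
    H.FunctionField ≃+* H.FunctionField :=
  IsFractionRing.ringEquivOfRingEquiv (H.galoisCoordinateRing σ)

theorem galoisFunctionField_x (σ : AlgebraicClosure K ≃ₐ[K] AlgebraicClosure K) :
    H.galoisFunctionField σ H.x = H.x := by
  simp [galoisFunctionField, x, galoisCoordinateRing]

theorem galoisFunctionField_y (σ : AlgebraicClosure K ≃ₐ[K] AlgebraicClosure K) :
    H.galoisFunctionField σ H.y = H.y := by
  simp [galoisFunctionField, y, galoisCoordinateRing]

theorem galoisFunctionField_algebraMap (σ : AlgebraicClosure K ≃ₐ[K] AlgebraicClosure K)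
    (c : AlgebraicClosure K) :
    H.galoisFunctionField σ (algebraMap (AlgebraicClosure K) H.FunctionField c) =
      algebraMap (AlgebraicClosure K) H.FunctionField (σ.toRingEquiv c) := by
  have hc : ∀ c, algebraMap (AlgebraicClosure K) H.FunctionField c =
      algebraMap H.CoordinateRing H.FunctionField (AdjoinRoot.of H.equation (C c)) := fun c => by
    rw [IsScalarTower.algebraMap_apply (AlgebraicClosure K) H.CoordinateRing H.FunctionField]
    rfl
  rw [hc, hc]
  simp [galoisFunctionField, galoisCoordinateRing]

/-- The divisor class group of the curve over the algebraic closure of `K`. -/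
abbrev DivisorClassGroup : Type _ :=
  Divisor.ClassGroup (AlgebraicClosure K) H.FunctionField

/-- The action of the absolute Galois group on divisor classes. -/
noncomputable def galoisClass (σ : AlgebraicClosure K ≃ₐ[K] AlgebraicClosure K) :
    H.DivisorClassGroup →+ H.DivisorClassGroup :=
  Divisor.classMap (H.galoisFunctionField σ) σ.toRingEquiv (H.galoisFunctionField_algebraMap σ)

/-- The group `J(K)` of rational points of the Jacobian of a genus-2 curve over a perfect field `K`.
The points of `J` over the algebraic closure are the divisor classes of degree zero, and the
`K`-rational ones among them are those fixed by the absolute Galois group of `K`. -/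
noncomputable def jacobianRationalPoints [PerfectField K] : AddSubgroup H.DivisorClassGroup :=
  Divisor.picZero (AlgebraicClosure K) H.FunctionField ⊓
    ⨅ σ : AlgebraicClosure K ≃ₐ[K] AlgebraicClosure K,
      (H.galoisClass σ - AddMonoidHom.id _).ker

theorem mem_jacobianRationalPoints [PerfectField K] (c : H.DivisorClassGroup) :
    c ∈ H.jacobianRationalPoints ↔
      c ∈ Divisor.picZero (AlgebraicClosure K) H.FunctionField ∧
        ∀ σ : AlgebraicClosure K ≃ₐ[K] AlgebraicClosure K, H.galoisClass σ c = c := by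
  simp [jacobianRationalPoints, AddSubgroup.mem_iInf, AddMonoidHom.mem_ker, sub_eq_zero]

end GenusTwoCurve

open Polynomial in
/-- The genus-2 curve `y² + (2x³ - 3x² - 41x + 110) y = x³ - 51x² + 425x + 179` over `ℚ`. -/
noncomputable def curveC70 : GenusTwoCurve ℚ where
  h := 2 * X ^ 3 - 3 * X ^ 2 - 41 * X + 110
  f := X ^ 3 - 51 * X ^ 2 + 425 * X + 179
  natDegree_h_le := by compute_degree
  natDegree_f_le := by compute_degree!
  smooth_affine := by
    rintro x y h1 ⟨h2, h3⟩
    simp only [map_add, map_sub, map_mul, map_pow, aeval_X, map_ofNat,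
      derivative_mul, derivative_X_pow, derivative_X, derivative_ofNat,
      map_one, map_zero, map_natCast] at h1 h2 h3
    push_cast at h1 h2 h3
    have hD : (4 * x ^ 6 - 12 * x ^ 5 - 155 * x ^ 4 + 690 * x ^ 3 + 817 * x ^ 2 - 7320 * x
        + 12816 : AlgebraicClosure ℚ) = 0 := by
      linear_combination (2 * y + (2 * x ^ 3 - 3 * x ^ 2 - 41 * x + 110)) * h2 - 4 * h1
    have hD' : (24 * x ^ 5 - 60 * x ^ 4 - 620 * x ^ 3 + 2070 * x ^ 2 + 1634 * x - 7320 :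
        AlgebraicClosure ℚ) = 0 := by
      linear_combination 2 * (6 * x ^ 2 - 6 * x - 41) * h2 - 4 * h3
    have : (16779697250494464 : AlgebraicClosure ℚ) = 0 := by
      linear_combination (3096718750014 + 949868188658 * x - 212191831348 * x ^ 2
        - 19672839828 * x ^ 3 + 5129493960 * x ^ 4) * hD
        + (3129487739028 - 735093931515 * x - 254859330202 * x ^ 2 + 45837207089 * x ^ 3
          + 3706264468 * x ^ 4 - 854915660 * x ^ 5) * hD'
    norm_num at this
  smooth_infinity := by
    rintro w h1 ⟨h2, -⟩
    have e1 : (2 * X ^ 3 - 3 * X ^ 2 - 41 * X + 110 : ℚ[X]).coeff 3 = 2 := by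
      compute_degree!
    have e2 : (X ^ 3 - 51 * X ^ 2 + 425 * X + 179 : ℚ[X]).coeff 6 = 0 := by
      compute_degree!
    rw [e1, map_ofNat] at h1 h2
    rw [e2, map_zero] at h1
    have : (4 : AlgebraicClosure ℚ) = 0 := by
      linear_combination (2 * w + 2) * h2 - 4 * h1
    norm_num at this

/-! Write A = (2, 17), B = (4, 23), let A' = (2, -49) and B' = (4, -49) be their images under the
hyperelliptic involution (x, y) ↦ (x, -y - h(x)), and let P and M be the points at infinity where
y/x³ takes the values 0 and -2. The class to study is D = A + B - P - M.

Upper bound. Four functions have all their zeros and poles among these six points: three of the form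
α(x) + β(x) y, and x - 4. They give the relations 5B ~ 5M, 2A + B' + P ~ 4M, 4A + B ~ 3P + 2M and B
+ B' ~ P + M, and an integral combination of these is 70 D ~ 0. The divisors are read off from
norms: the product of α + β y with its conjugate is the polynomial α² - αβh - β²f, here a constant
times powers of x - 2 and x - 4. At a point not fixed by the involution, where the conjugate does
not vanish, the order of the function is the multiplicity of the zero of this polynomial
(`Place.IsChart.val_eq_pow_of_norm`). The same argument in the coordinates 1/x, y/x³ handles
infinity.

Lower bound. It remains to see that 35 D, 14 D and 10 D are not principal. Modulo the relations, 35
D, 56 D and 40 D become A + 3B' - 2P - 2M, B - M and 2A + B - P - 2M. If such a divisor were div(g),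
then g would have no affine poles and poles of order at most 2 at infinity. Such a g is invariant
under the involution (`GenusTwoCurve.involution_eq_self`): g minus its conjugate is (b/d)(2y + h),
regularity forces d to be constant because (2y + h)² = h² + 4f is squarefree, and 2y + h already has
a pole of order 3 at infinity, so b = 0. But none of the three divisors is symmetric under the
involution.

Foundations. Points are places, so both existence and uniqueness of the place over given coordinates
have to be shown. Existence comes from embedding the function field into Laurent series with
Hensel's lemma. Uniqueness holds since near a point not fixed by the involution every nonzero
function is a power of t - a times a unit, with an exponent depending only on the function.
Uniqueness also makes the four points in D Galois stable, as their coordinates are rational. -/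

section

open Polynomial

/-! ### The function field: normal form of functions, embeddings, the involution -/

namespace GenusTwoCurve

variable {K : Type*} [Field K] (H : GenusTwoCurve K)

/-- The polynomial `h` over the algebraic closure. -/
noncomputable abbrev hBar : (AlgebraicClosure K)[X] := H.h.map (algebraMap K (AlgebraicClosure K))

/-- The polynomial `f` over the algebraic closure. -/
noncomputable abbrev fBar : (AlgebraicClosure K)[X] := H.f.map (algebraMap K (AlgebraicClosure K))

theorem equation_monic : H.equation.Monic := by
  rw [equation_eq_cubic]; exact Cubic.monic_of_b_eq_one'

theorem natDegree_equation : H.equation.natDegree = 2 := by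
  rw [equation_eq_cubic]; exact Cubic.natDegree_of_b_ne_zero' one_ne_zero

theorem algebraMap_of (p : (AlgebraicClosure K)[X]) :
    algebraMap H.CoordinateRing H.FunctionField (AdjoinRoot.of H.equation p) = aeval H.x p := by
  induction p using Polynomial.induction_on' with
  | add p q hp hq => simp only [map_add, hp, hq]
  | monomial n c =>
    rw [← C_mul_X_pow_eq_monomial]
    simp only [map_mul, map_pow, aeval_X, aeval_C]
    congr 1

theorem y_equation : H.y ^ 2 + aeval H.x H.hBar * H.y = aeval H.x H.fBar := by
  have h : AdjoinRoot.mk H.equation (X ^ 2 + C H.hBar * X - C H.fBar) = 0 := AdjoinRoot.mk_self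
  have h2 := congrArg (algebraMap H.CoordinateRing H.FunctionField) h
  rw [map_sub, map_add, map_mul, map_pow, AdjoinRoot.mk_C, AdjoinRoot.mk_C, AdjoinRoot.mk_X,
    map_sub, map_add, map_mul, map_pow, algebraMap_of, algebraMap_of, map_zero] at h2
  exact sub_eq_zero.1 h2

theorem aeval_x_injective : Function.Injective (aeval H.x : (AlgebraicClosure K)[X] → _) := by
  intro p q hpq
  rw [← algebraMap_of, ← algebraMap_of] at hpq
  refine AdjoinRoot.of.injective_of_degree_ne_zero ?_
    (IsFractionRing.injective H.CoordinateRing H.FunctionField hpq)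
  rw [degree_eq_natDegree H.equation_monic.ne_zero, natDegree_equation]
  norm_num

theorem exists_coordinateRing_rep (r : H.CoordinateRing) : ∃ A B : (AlgebraicClosure K)[X],
    algebraMap H.CoordinateRing H.FunctionField r = aeval H.x A + aeval H.x B * H.y := by
  obtain ⟨p, rfl⟩ := AdjoinRoot.mk_surjective r
  have hd : (p %ₘ H.equation).natDegree ≤ 1 := by
    have := natDegree_modByMonic_lt p H.equation_monic (by
      intro h; have := H.natDegree_equation; rw [h] at this; simp at this)
    rw [natDegree_equation] at this
    omega
  have hp : AdjoinRoot.mk H.equation p = AdjoinRoot.mk H.equation (p %ₘ H.equation) := by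
    rw [AdjoinRoot.mk_eq_mk, modByMonic_eq_sub_mul_div]
    simp
  refine ⟨(p %ₘ H.equation).coeff 0, (p %ₘ H.equation).coeff 1, ?_⟩
  rw [hp]
  conv_lhs => rw [eq_X_add_C_of_natDegree_le_one hd]
  rw [map_add, map_mul, AdjoinRoot.mk_C, AdjoinRoot.mk_C, AdjoinRoot.mk_X, map_add, map_mul,
    algebraMap_of, algebraMap_of, add_comm]
  rfl

/-- The coordinate ring is finite over the polynomials in x, so `r` is integral over them and
divides a nonzero polynomial. This clears y from denominators and reduces injectivity of a map to
injectivity on polynomials in x. -/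
theorem exists_dvd_aeval {r : H.CoordinateRing} (hr : r ≠ 0) :
    ∃ C : (AlgebraicClosure K)[X], C ≠ 0 ∧ ∃ s, AdjoinRoot.of H.equation C = r * s := by
  have := H.equation_monic.finite_adjoinRoot
  obtain ⟨C, hC, s, hs⟩ := (Algebra.IsIntegral.isIntegral (R := (AlgebraicClosure K)[X])
    r).isAlgebraic.exists_nonzero_dvd (mem_nonZeroDivisors_of_ne_zero hr)
  exact ⟨C, hC, s, hs⟩

/-- Every function is `(A(x) + B(x) y) / C(x)`. -/
theorem exists_rep (g : H.FunctionField) : ∃ A B C : (AlgebraicClosure K)[X], C ≠ 0 ∧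
    aeval H.x C * g = aeval H.x A + aeval H.x B * H.y := by
  obtain ⟨r, s, hs, rfl⟩ := IsFractionRing.div_surjective (A := H.CoordinateRing) g
  obtain ⟨C, hC, t, ht⟩ := H.exists_dvd_aeval (nonZeroDivisors.ne_zero hs)
  obtain ⟨A, B, hr⟩ := H.exists_coordinateRing_rep (r * t)
  refine ⟨A, B, C, hC, ?_⟩
  have hs0 : algebraMap H.CoordinateRing H.FunctionField s ≠ 0 := by
    rw [Ne, FaithfulSMul.algebraMap_eq_zero_iff]
    exact nonZeroDivisors.ne_zero hs
  rw [← hr, ← algebraMap_of, ht, map_mul, map_mul]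
  field_simp

/-- A solution of the equation of the curve with transcendental first coordinate gives an embedding
of the function field. -/
theorem exists_algHom {L : Type*} [Field L] [Algebra (AlgebraicClosure K) L] (x₀ y₀ : L)
    (hx : Transcendental (AlgebraicClosure K) x₀)
    (hy : y₀ ^ 2 + aeval x₀ H.hBar * y₀ = aeval x₀ H.fBar) :
    ∃ φ : H.FunctionField →ₐ[AlgebraicClosure K] L, φ H.x = x₀ ∧ φ H.y = y₀ := by
  let ψ : H.CoordinateRing →ₐ[AlgebraicClosure K] L :=
    AdjoinRoot.liftAlgHom H.equation (aeval x₀) y₀ (by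
      rw [equation, eval₂_sub, eval₂_add, eval₂_mul, eval₂_pow, eval₂_X, eval₂_C, eval₂_C]
      exact sub_eq_zero.2 hy)
  have hof : ∀ C, ψ (AdjoinRoot.of H.equation C) = aeval x₀ C := fun C =>
    AdjoinRoot.liftAlgHom_of ..
  -- A nonzero element of the kernel would divide a nonzero polynomial in x, and that polynomial
  -- would then vanish at the transcendental `x₀`.
  have hψ : Function.Injective ψ := by
    rw [injective_iff_map_eq_zero]
    intro r hr
    by_contra hr0
    obtain ⟨C, hC, s, hs⟩ := H.exists_dvd_aeval hr0
    refine hC ((transcendental_iff.1 hx) C ?_)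
    rw [← hof, hs, map_mul, hr, zero_mul]
  refine ⟨IsFractionRing.liftAlgHom (K := H.FunctionField) hψ, ?_, ?_⟩
  · rw [IsFractionRing.liftAlgHom_apply, x]
    exact (IsFractionRing.lift_algebraMap _ _).trans ((hof X).trans (aeval_X _))
  · rw [IsFractionRing.liftAlgHom_apply, y]
    exact (IsFractionRing.lift_algebraMap _ _).trans (AdjoinRoot.liftAlgHom_root ..)

theorem transcendental_x : Transcendental (AlgebraicClosure K) H.x := by
  rw [transcendental_iff]
  exact fun p hp => H.aeval_x_injective (by rw [hp, map_zero])

/-- The hyperelliptic involution exists. -/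
theorem exists_involution : ∃ φ : H.FunctionField ≃ₐ[AlgebraicClosure K] H.FunctionField,
    φ H.x = H.x ∧ φ H.y = -H.y - aeval H.x H.hBar ∧ ∀ g, φ (φ g) = g := by
  obtain ⟨φ, hx, hy⟩ := H.exists_algHom H.x (-H.y - aeval H.x H.hBar) H.transcendental_x (by
    linear_combination H.y_equation)
  have hp : ∀ p : (AlgebraicClosure K)[X], φ (aeval H.x p) = aeval H.x p := fun p => by
    rw [← aeval_algHom_apply, hx]
  -- `φ ∘ φ` fixes x and y, and the normal form C g = A + B y determines g.
  have hφ : ∀ g, φ (φ g) = g := fun g => by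
    obtain ⟨A, B, C, hC, h⟩ := H.exists_rep g
    have h2 := congrArg (φ ∘ φ) h
    simp only [Function.comp_apply, map_mul, map_add, map_sub, map_neg, hp, hy] at h2
    refine mul_left_cancel₀ (a := aeval H.x C) ?_ ?_
    · exact fun h0 => hC (H.aeval_x_injective (by rw [h0, map_zero]))
    · rw [h2, h]; ring
  exact ⟨AlgEquiv.ofAlgHom φ φ (AlgHom.ext hφ) (AlgHom.ext hφ), hx, hy, hφ⟩

/-- The hyperelliptic involution `(x, y) ↦ (x, -y - h(x))`. -/
noncomputable def involution : H.FunctionField ≃ₐ[AlgebraicClosure K] H.FunctionField :=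
  H.exists_involution.choose

theorem involution_x : H.involution H.x = H.x := H.exists_involution.choose_spec.1

theorem involution_y : H.involution H.y = -H.y - aeval H.x H.hBar :=
  H.exists_involution.choose_spec.2.1

theorem involution_involution (g : H.FunctionField) : H.involution (H.involution g) = g :=
  H.exists_involution.choose_spec.2.2 g

theorem involution_aeval (p : (AlgebraicClosure K)[X]) :
    H.involution (aeval H.x p) = aeval H.x p := by
  rw [← aeval_algHom_apply, involution_x]

end GenusTwoCurve

namespace Polynomial

variable {k : Type*} [Field k]

/-- Two polynomials, not both zero, are coprime up to a nonzero common factor. -/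
theorem exists_isCoprime_of_ne_zero (A B : k[X]) (h : A ≠ 0 ∨ B ≠ 0) :
    ∃ d A' B' : k[X], d ≠ 0 ∧ IsCoprime A' B' ∧ A = d * A' ∧ B = d * B' := by
  classical
  have hd : EuclideanDomain.gcd A B ≠ 0 := by
    rw [Ne, EuclideanDomain.gcd_eq_zero_iff]
    tauto
  obtain ⟨A', hA⟩ := EuclideanDomain.gcd_dvd_left A B
  obtain ⟨B', hB⟩ := EuclideanDomain.gcd_dvd_right A B
  refine ⟨_, A', B', hd, ?_, hA, hB⟩
  refine ⟨EuclideanDomain.gcdA A B, EuclideanDomain.gcdB A B, mul_left_cancel₀ hd ?_⟩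
  have h1 := EuclideanDomain.gcd_eq_gcd_ab A B
  calc _ = (EuclideanDomain.gcd A B * A') * EuclideanDomain.gcdA A B +
        (EuclideanDomain.gcd A B * B') * EuclideanDomain.gcdB A B := by ring
    _ = _ := by rw [← hA, ← hB, ← h1, mul_one]

theorem exists_eq_X_sub_C_pow_mul (p : k[X]) (hp : p ≠ 0) (a : k) :
    ∃ (n : ℕ) (q : k[X]), p = (X - C a) ^ n * q ∧ q.eval a ≠ 0 := by
  obtain ⟨q, hq, hd⟩ := exists_eq_pow_rootMultiplicity_mul_and_not_dvd p hp a
  exact ⟨_, q, hq, by rwa [dvd_iff_isRoot] at hd⟩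

end Polynomial

/-! ### Values of polynomials in one function at a place -/

namespace Place

variable {k F : Type*} [Field k] [Field F] [Algebra k F] (v : Place k F)

theorem val_algebraMap_le (c : k) : v.val (algebraMap k F c) ≤ 1 := by
  by_cases hc : c = 0
  · simp [hc]
  · exact (v.trivial c hc).le

theorem val_aeval_le {t : F} (ht : v.val t ≤ 1) (p : k[X]) : v.val (aeval t p) ≤ 1 := by
  induction p using Polynomial.induction_on' with
  | add p q hp hq => rw [map_add]; exact v.val.map_add_le hp hq
  | monomial n c =>
    rw [← C_mul_X_pow_eq_monomial]
    simp only [map_mul, map_pow, aeval_X, aeval_C]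
    exact mul_le_one' (v.val_algebraMap_le c) (pow_le_one' ht n)

theorem val_le_of_sub_lt {t : F} {a : k} (ht : v.val (t - algebraMap k F a) < 1) :
    v.val t ≤ 1 := by
  rw [← sub_add_cancel t (algebraMap k F a)]
  exact v.val.map_add_le ht.le (v.val_algebraMap_le a)

theorem val_aeval_sub_eval_lt {t : F} {a : k} (ht : v.val (t - algebraMap k F a) < 1) (p : k[X]) :
    v.val (aeval t p - algebraMap k F (p.eval a)) < 1 := by
  obtain ⟨q, hq⟩ := X_sub_C_dvd_sub_C_eval (a := a) (p := p)
  have h := congrArg (aeval t) hq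
  simp only [map_sub, map_mul, aeval_X, aeval_C] at h
  rw [h, map_mul]
  exact mul_lt_one_of_lt_of_le ht (v.val_aeval_le (v.val_le_of_sub_lt ht) q)

theorem val_eq_one_of_sub_lt {g : F} {c : k} (hc : c ≠ 0)
    (h : v.val (g - algebraMap k F c) < 1) : v.val g = 1 := by
  rw [← v.trivial c hc] at h ⊢
  exact Valuation.map_eq_of_sub_lt _ h

theorem val_aeval_eq_one {t : F} {a : k} (ht : v.val (t - algebraMap k F a) < 1) {p : k[X]}
    (hp : p.eval a ≠ 0) : v.val (aeval t p) = 1 :=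
  v.val_eq_one_of_sub_lt hp (v.val_aeval_sub_eval_lt ht p)

theorem eq_of_val_sub_lt {g : F} {c d : k} (hc : v.val (g - algebraMap k F c) < 1)
    (hd : v.val (g - algebraMap k F d) < 1) : c = d := by
  by_contra hne
  have h := v.val.map_sub_lt hd hc
  rw [sub_sub_sub_cancel_left, ← map_sub, v.trivial _ (sub_ne_zero.2 hne)] at h
  exact lt_irrefl _ h

/-- At a pole of `x`, the order of a polynomial in `x` is determined by its degree. -/
theorem val_aeval_of_one_lt {t : F} (ht : 1 < v.val t) {p : k[X]} (hp : p ≠ 0) :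
    v.val (aeval t p) = v.val t ^ p.natDegree := by
  have ht0 : v.val t ≠ 0 := (zero_lt_one.trans ht).ne'
  induction hn : p.natDegree using Nat.strong_induction_on generalizing p with
  | _ n ih =>
    have hlead : v.val (aeval t (C p.leadingCoeff * X ^ n)) = v.val t ^ n := by
      rw [map_mul, map_pow, aeval_X, aeval_C, map_mul, map_pow,
        v.trivial _ (leadingCoeff_ne_zero.2 hp), one_mul]
    by_cases he : p.eraseLead = 0
    · rw [← hlead]
      conv_lhs => rw [← eraseLead_add_C_mul_X_pow p, he, zero_add, hn]
    · have hlt : p.eraseLead.natDegree < n := by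
        by_cases hn0 : p.natDegree = 0
        · exact absurd (by rw [eq_C_of_natDegree_eq_zero hn0, eraseLead_C]) he
        · exact hn ▸ lt_of_le_of_lt (eraseLead_natDegree_le p) (by omega)
      rw [← hlead]
      conv_lhs => rw [← eraseLead_add_C_mul_X_pow p, hn, map_add]
      -- Since t has a pole, the leading term strictly dominates the remaining ones, whose size the
      -- induction hypothesis gives.
      apply Valuation.map_add_eq_of_lt_right
      rw [hlead, ih _ hlt he rfl]
      exact pow_lt_pow_right₀ ht hlt

/-- A presentation of a function field by functions `t` and `w` with `w² + p(t) w = q(t)`. -/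
structure IsChart (t w : F) (p q : k[X]) : Prop where
  equation : w ^ 2 + aeval t p * w = aeval t q
  exists_rep : ∀ g : F, ∃ A B C : k[X], C ≠ 0 ∧ aeval t C * g = aeval t A + aeval t B * w
  injective : Function.Injective (aeval t : k[X] → F)

/-! ### Local theory of a chart: uniformizers, uniqueness of places, orders from norms -/

namespace IsChart

variable {t w : F} {p q : k[X]}

theorem aeval_ne_zero (h : IsChart t w p q) {A : k[X]} (hA : A ≠ 0) : aeval t A ≠ 0 :=
  fun h0 => hA (h.injective (by rw [h0, map_zero]))

theorem sub_ne_zero (h : IsChart t w p q) (a : k) : t - algebraMap k F a ≠ 0 := by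
  have := h.aeval_ne_zero (X_sub_C_ne_zero a)
  simpa using this

/-- If w had a pole where t has none, then w + p(t) would have the same pole, and their product q(t)
could not be regular. -/
theorem val_le_one (h : IsChart t w p q) (v : Place k F) (ht : v.val t ≤ 1) : v.val w ≤ 1 := by
  by_contra! hw
  have h1 : v.val (w * (w + aeval t p)) ≤ 1 := by
    rw [show w * (w + aeval t p) = aeval t q by rw [← h.equation]; ring]
    exact v.val_aeval_le ht q
  have h2 : v.val (w + aeval t p) = v.val w :=
    Valuation.map_add_eq_of_lt_left _ ((v.val_aeval_le ht p).trans_lt hw)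
  rw [map_mul, h2] at h1
  exact absurd h1 (not_le.2 (hw.trans_le (le_mul_of_one_le_right' hw.le)))

/-- The place lies over one of the two points with the same first coordinate. -/
theorem val_sub_lt_or (h : IsChart t w p q) (v : Place k F) {a b : k}
    (hb : b ^ 2 + p.eval a * b = q.eval a) (ht : v.val (t - algebraMap k F a) < 1) :
    v.val (w - algebraMap k F b) < 1 ∨ v.val (w - algebraMap k F (-b - p.eval a)) < 1 := by
  have h1 : v.val ((w - algebraMap k F b) * (w - algebraMap k F (-b - p.eval a))) < 1 := by
    have hb' := congrArg (algebraMap k F) hb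
    simp only [map_add, map_mul, map_pow] at hb'
    rw [show (w - algebraMap k F b) * (w - algebraMap k F (-b - p.eval a)) =
        (aeval t q - algebraMap k F (q.eval a)) - (aeval t p - algebraMap k F (p.eval a)) * w by
      rw [← h.equation, ← hb', map_sub, map_neg]; ring]
    refine v.val.map_sub_lt (v.val_aeval_sub_eval_lt ht q) ?_
    rw [map_mul]
    exact mul_lt_one_of_lt_of_le (v.val_aeval_sub_eval_lt ht p)
      (h.val_le_one v (v.val_le_of_sub_lt ht))
  by_contra! h2
  rw [map_mul] at h1
  exact absurd h1 (not_lt.2 (one_le_mul h2.1 h2.2))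

/-- The function A(t) + B(t) w has the residue A(a) + B(a) b at the point (a, b); a nonzero residue
means order zero. -/
theorem val_eq_one (v : Place k F) {a b : k} (ht : v.val (t - algebraMap k F a) < 1)
    (hw : v.val (w - algebraMap k F b) < 1) {A B : k[X]} (hAB : A.eval a + B.eval a * b ≠ 0) :
    v.val (aeval t A + aeval t B * w) = 1 := by
  refine v.val_eq_one_of_sub_lt hAB ?_
  rw [map_add, map_mul, show aeval t A + aeval t B * w - (algebraMap k F (A.eval a) +
      algebraMap k F (B.eval a) * algebraMap k F b) = (aeval t A - algebraMap k F (A.eval a)) +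
      ((aeval t B - algebraMap k F (B.eval a)) * w +
        algebraMap k F (B.eval a) * (w - algebraMap k F b)) by ring]
  refine v.val.map_add_lt (v.val_aeval_sub_eval_lt ht A) (v.val.map_add_lt ?_ ?_)
  · rw [map_mul]
    exact mul_lt_one_of_lt_of_le (v.val_aeval_sub_eval_lt ht B) (v.val_le_of_sub_lt hw)
  · rw [map_mul, mul_comm]
    exact mul_lt_one_of_lt_of_le hw (v.val_algebraMap_le _)

theorem val_conj_eq_one (v : Place k F) {a b : k} (ht : v.val (t - algebraMap k F a) < 1)
    (hw : v.val (w - algebraMap k F b) < 1) {A B : k[X]}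
    (hAB : A.eval a + B.eval a * (-b - p.eval a) ≠ 0) :
    v.val (aeval t A + aeval t B * (-w - aeval t p)) = 1 := by
  have := val_eq_one (A := A - B * p) (B := -B) v ht hw (by
    rw [eval_sub, eval_mul, eval_neg]
    convert hAB using 1
    ring)
  rw [← this, map_sub, map_mul, map_neg]
  congr 1
  ring

/-- The second root of the quadratic equation of w is -w - p(t), so this product is the norm to the
polynomials in t. All orders of functions below are computed from it. -/
theorem mul_conj (h : IsChart t w p q) (A B : k[X]) :
    (aeval t A + aeval t B * w) * (aeval t A + aeval t B * (-w - aeval t p)) =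
      aeval t (A ^ 2 - A * B * p - B ^ 2 * q) := by
  simp only [map_sub, map_mul, map_pow]
  linear_combination -(aeval t B) ^ 2 * h.equation

/-- The order of a function that vanishes at a point but not at the conjugate point is the
multiplicity of the zero of its norm. -/
theorem val_eq_pow_of_norm (h : IsChart t w p q) (v : Place k F) {a b : k}
    (ht : v.val (t - algebraMap k F a) < 1) (hw : v.val (w - algebraMap k F b) < 1) {A B N : k[X]}
    {n : ℕ} (hAB : A.eval a + B.eval a * (-b - p.eval a) ≠ 0)
    (hN : A ^ 2 - A * B * p - B ^ 2 * q = (X - C a) ^ n * N) (hNa : N.eval a ≠ 0) :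
    v.val (aeval t A + aeval t B * w) = v.val (t - algebraMap k F a) ^ n := by
  have h1 := congrArg v.val (h.mul_conj A B)
  rw [map_mul, val_conj_eq_one v ht hw hAB, mul_one, hN, map_mul, map_mul,
    v.val_aeval_eq_one ht hNa, mul_one] at h1
  simpa using h1

/-- The exponent is chosen before the place, and this is what later yields uniqueness of the place.
After the common factor of `A` and `B` is removed, the function and its conjugate cannot both vanish
at the point, so either the order is zero or the norm determines it. -/
theorem exists_val_eq_pow_of_rep (h : IsChart t w p q) {a b : k} (hab : 2 * b + p.eval a ≠ 0)
    (A B : k[X]) (h0 : aeval t A + aeval t B * w ≠ 0) :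
    ∃ n : ℕ, ∀ v : Place k F, v.val (t - algebraMap k F a) < 1 →
      v.val (w - algebraMap k F b) < 1 →
      v.val (aeval t A + aeval t B * w) = v.val (t - algebraMap k F a) ^ n := by
  have hne : A ≠ 0 ∨ B ≠ 0 := by
    by_contra! hAB
    simp [hAB.1, hAB.2] at h0
  obtain ⟨d, A, B, hd, hc, rfl, rfl⟩ := exists_isCoprime_of_ne_zero A B hne
  obtain ⟨m, d', rfl, hd'⟩ := exists_eq_X_sub_C_pow_mul d hd a
  have key : ∃ n : ℕ, ∀ v : Place k F, v.val (t - algebraMap k F a) < 1 →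
      v.val (w - algebraMap k F b) < 1 →
      v.val (aeval t A + aeval t B * w) = v.val (t - algebraMap k F a) ^ n := by
    by_cases h1 : A.eval a + B.eval a * b = 0
    · have h2 : A.eval a + B.eval a * (-b - p.eval a) ≠ 0 := by
        intro h2
        -- Subtracting the two vanishing values leaves B(a)(2b + p(a)) = 0; the point is not fixed
        -- by the conjugation, so B(a) = 0, then A(a) = 0, against coprimality.
        have hB : B.eval a = 0 := by
          refine (mul_eq_zero.1 ?_).resolve_right hab
          linear_combination h1 - h2
        have hA : A.eval a = 0 := by simpa [hB] using h1
        obtain ⟨r, s, hrs⟩ := hc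
        have := congrArg (eval a) hrs
        simp [hA, hB] at this
      by_cases hN : A ^ 2 - A * B * p - B ^ 2 * q = 0
      · refine ⟨0, fun v ht hw => ?_⟩
        exfalso
        have h3 := h.mul_conj A B
        rw [hN, map_zero] at h3
        have h4 := val_conj_eq_one v ht hw h2
        rcases mul_eq_zero.1 h3 with h5 | h5
        · apply h0
          simp only [map_mul]
          linear_combination (aeval t ((X - C a) ^ m) * aeval t d') * h5
        · rw [h5, map_zero] at h4
          exact zero_ne_one h4
      · obtain ⟨n, N, hN', hNa⟩ := exists_eq_X_sub_C_pow_mul _ hN a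
        exact ⟨n, fun v ht hw => h.val_eq_pow_of_norm v ht hw h2 hN' hNa⟩
    · exact ⟨0, fun v ht hw => by rw [val_eq_one v ht hw h1, pow_zero]⟩
  obtain ⟨n, hn⟩ := key
  refine ⟨m + n, fun v ht hw => ?_⟩
  have h3 := hn v ht hw
  rw [show aeval t ((X - C a) ^ m * d' * A) + aeval t ((X - C a) ^ m * d' * B) * w =
    (t - algebraMap k F a) ^ m * (aeval t d' * (aeval t A + aeval t B * w)) by
      simp only [map_mul, map_pow, map_sub, aeval_X, aeval_C]; ring]
  rw [map_mul, map_mul, v.val_aeval_eq_one ht hd', one_mul, h3, map_pow, pow_add]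

/-- Every function is, up to functions of order zero, a power of `t - a` near a point `(a, b)`
that is not fixed by the conjugation. -/
theorem exists_val_eq_zpow (h : IsChart t w p q) {a b : k} (hab : 2 * b + p.eval a ≠ 0)
    {g : F} (hg : g ≠ 0) :
    ∃ n : ℤ, ∀ v : Place k F, v.val (t - algebraMap k F a) < 1 →
      v.val (w - algebraMap k F b) < 1 → v.val g = v.val (t - algebraMap k F a) ^ n := by
  obtain ⟨A, B, D, hD, hrep⟩ := h.exists_rep g
  have hD0 := h.aeval_ne_zero hD
  obtain ⟨m, hm⟩ := h.exists_val_eq_pow_of_rep hab A B (hrep ▸ mul_ne_zero hD0 hg)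
  obtain ⟨n, hn⟩ := h.exists_val_eq_pow_of_rep hab D 0 (by simpa using hD0)
  refine ⟨m - n, fun v ht hw => ?_⟩
  have h1 := hm v ht hw
  have h2 := hn v ht hw
  rw [map_zero, zero_mul, add_zero] at h2
  rw [← hrep, map_mul, h2] at h1
  have h3 : v.val (t - algebraMap k F a) ≠ 0 := (Valuation.ne_zero_iff _).2 (h.sub_ne_zero a)
  rw [zpow_sub₀ h3, zpow_natCast, zpow_natCast, ← h1, mul_div_cancel_left₀]
  exact pow_ne_zero _ h3

/-- The function `t - a` is a uniformizer at a point `(a, b)` not fixed by the conjugation. -/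
theorem val_sub_eq (h : IsChart t w p q) {a b : k} (hab : 2 * b + p.eval a ≠ 0) (v : Place k F)
    (ht : v.val (t - algebraMap k F a) < 1) (hw : v.val (w - algebraMap k F b) < 1) :
    v.val (t - algebraMap k F a) = WithZero.exp (-1) := by
  -- The value group is all of ℤ, so some g has order 1. It is a power of t - a up to a unit, hence
  -- the order of t - a divides 1, and it is positive.
  obtain ⟨g, hg⟩ := v.surjective (WithZero.exp (-1))
  have hg0 : g ≠ 0 := by
    rintro rfl
    rw [map_zero] at hg
    exact WithZero.exp_ne_zero hg.symm
  obtain ⟨n, hn⟩ := h.exists_val_eq_zpow hab hg0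
  have h1 := hn v ht hw
  have h3 : v.val (t - algebraMap k F a) ≠ 0 := (Valuation.ne_zero_iff _).2 (h.sub_ne_zero a)
  generalize v.val (t - algebraMap k F a) = e at *
  obtain ⟨m, rfl⟩ : ∃ m : ℤ, e = WithZero.exp m := ⟨_, (WithZero.exp_log h3).symm⟩
  rw [hg, ← WithZero.exp_zsmul, WithZero.exp_inj] at h1
  rw [← WithZero.exp_zero, WithZero.exp_lt_exp] at ht
  rw [WithZero.exp_inj]
  have h4 : m ∣ 1 := ⟨-n, by rw [smul_eq_mul] at h1; linarith⟩
  have := Int.isUnit_iff.1 (isUnit_of_dvd_one h4)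
  omega

/-- There is at most one place over a point not fixed by the conjugation. -/
theorem unique (h : IsChart t w p q) {a b : k} (hab : 2 * b + p.eval a ≠ 0) {u v : Place k F}
    (hut : u.val (t - algebraMap k F a) < 1) (huw : u.val (w - algebraMap k F b) < 1)
    (hvt : v.val (t - algebraMap k F a) < 1) (hvw : v.val (w - algebraMap k F b) < 1) :
    u = v := by
  refine ext_val fun g => ?_
  by_cases hg : g = 0
  · simp [hg]
  · obtain ⟨n, hn⟩ := h.exists_val_eq_zpow hab hg
    rw [hn u hut huw, hn v hvt hvw, h.val_sub_eq hab u hut huw, h.val_sub_eq hab v hvt hvw]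

theorem ord_eq (h : IsChart t w p q) {a b : k} (hab : 2 * b + p.eval a ≠ 0) (v : Place k F)
    (ht : v.val (t - algebraMap k F a) < 1) (hw : v.val (w - algebraMap k F b) < 1) {A B N : k[X]}
    {n : ℕ} (hAB : A.eval a + B.eval a * (-b - p.eval a) ≠ 0)
    (hN : A ^ 2 - A * B * p - B ^ 2 * q = (X - C a) ^ n * N) (hNa : N.eval a ≠ 0) :
    v.ord (aeval t A + aeval t B * w) = n := by
  rw [ord, h.val_eq_pow_of_norm v ht hw hAB hN hNa, h.val_sub_eq hab v ht hw, WithZero.log_pow,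
    WithZero.log_exp]
  simp

end IsChart
end Place

theorem Polynomial.aeval_inv_mul_pow {k F : Type*} [Field k] [Field F] [Algebra k F] {t : F}
    (ht : t ≠ 0) {p : k[X]} {N : ℕ} (hp : p.natDegree ≤ N) :
    aeval t⁻¹ p * t ^ N = aeval t (reflect N p) := by
  have : Invertible t⁻¹ := invertibleOfNonzero (inv_ne_zero ht)
  have h := eval₂_reflect_mul_pow (algebraMap k F) t⁻¹ N p hp
  rw [invOf_eq_inv, inv_inv] at h
  rw [aeval_def, aeval_def, ← h, mul_assoc, ← mul_pow, inv_mul_cancel₀ ht, one_pow, mul_one]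

/-- A simple zero of a monic quadratic polynomial lifts to power series. -/
theorem exists_powerSeries_root {k : Type*} [Field k] (p q : PowerSeries k) (b : k)
    (hb : b ^ 2 + p.constantCoeff * b = q.constantCoeff) (hb' : 2 * b + p.constantCoeff ≠ 0) :
    ∃ e : PowerSeries k, e ^ 2 + p * e = q ∧ e.constantCoeff = b := by
  have hX : ∀ s : PowerSeries k, s ∈ Ideal.span {(PowerSeries.X : PowerSeries k)} ↔
      s.constantCoeff = 0 := fun s => by
    rw [Ideal.mem_span_singleton, PowerSeries.X_dvd_iff]
  -- Hensel's lemma in the X-adically complete ring of power series; the derivative at the root is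
  -- 2b + p(0), a unit.
  obtain ⟨e, he, hb0⟩ := HenselianRing.is_henselian
    (I := Ideal.span {(PowerSeries.X : PowerSeries k)})
    (X ^ 2 + Polynomial.C p * X - Polynomial.C q : (PowerSeries k)[X]) (by monicity!)
    (PowerSeries.C b) (by rw [hX]; simp [hb]) (by
      apply IsUnit.map
      rw [PowerSeries.isUnit_iff_constantCoeff]
      have h2 : (2 : PowerSeries k).constantCoeff = 2 := map_ofNat _ 2
      simpa [one_add_one_eq_two, h2] using hb')
  refine ⟨e, ?_, ?_⟩
  · simpa [sub_eq_zero] using he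
  · rw [hX] at hb0
    simpa [sub_eq_zero] using hb0

/-! ### The valuation on Laurent series -/

namespace LaurentSeries

variable {k : Type*} [Field k]

theorem coe_C_eq (c : k) : HahnSeries.ofPowerSeries ℤ k (PowerSeries.C c) =
    algebraMap k (LaurentSeries k) c := by
  rw [algebraMap_apply, HahnSeries.ofPowerSeries_C]

theorem valuation_algebraMap {c : k} (hc : c ≠ 0) :
    Valued.v (algebraMap k (LaurentSeries k) c) = 1 := by
  have h : ∀ c : k, Valued.v (algebraMap k (LaurentSeries k) c) ≤ 1 := fun c =>
    (val_le_one_iff_eq_coe k _).2 ⟨PowerSeries.C c, coe_C_eq c⟩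
  refine le_antisymm (h c) ?_
  have h2 := h c⁻¹
  rw [map_inv₀, map_inv₀] at h2
  exact (inv_le_one₀ (by simpa [zero_lt_iff] using hc)).1 h2

/-- Over an algebraically closed field the algebraic elements are the constants, and nonzero
constants have valuation 1. -/
theorem transcendental_of_valuation_ne_one [IsAlgClosed k] {s : LaurentSeries k} (hs : s ≠ 0)
    (hs1 : Valued.v s ≠ 1) : Transcendental k s := by
  intro h
  obtain ⟨c, rfl⟩ := minpoly.mem_range_of_degree_eq_one k s
    (IsAlgClosed.degree_eq_one_of_irreducible k (minpoly.irreducible h.isIntegral))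
  exact hs1 (valuation_algebraMap (by rintro rfl; simp at hs))

theorem aeval_coe (s : PowerSeries k) (p : k[X]) :
    aeval (HahnSeries.ofPowerSeries ℤ k s) p = HahnSeries.ofPowerSeries ℤ k (aeval s p) := by
  rw [aeval_def, aeval_def, hom_eval₂]
  congr 1

theorem valuation_coe_lt_one {s : PowerSeries k} (hs : s.constantCoeff = 0) :
    Valued.v (HahnSeries.ofPowerSeries ℤ k s) < 1 := by
  have h := (intValuation_le_iff_coeff_lt_eq_zero k (d := 1) s).2 (by
    intro n hn
    obtain rfl : n = 0 := by omega
    simpa using hs)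
  refine h.trans_lt ?_
  rw [← WithZero.exp_zero, WithZero.exp_lt_exp]
  norm_num

theorem valuation_coe_eq_one {s : PowerSeries k} (hs : s.constantCoeff ≠ 0) :
    Valued.v (HahnSeries.ofPowerSeries ℤ k s) = 1 := by
  have h : Valued.v (HahnSeries.ofPowerSeries ℤ k s - algebraMap k _ s.constantCoeff) < 1 := by
    have := valuation_coe_lt_one (s := s - PowerSeries.C s.constantCoeff) (by simp)
    rwa [map_sub, coe_C_eq] at this
  rw [← valuation_algebraMap hs] at h ⊢
  exact Valuation.map_eq_of_sub_lt _ h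

theorem valuation_coe_X :
    Valued.v (HahnSeries.ofPowerSeries ℤ k PowerSeries.X) = WithZero.exp (-1) := by
  rw [HahnSeries.ofPowerSeries_X, valuation_single_zpow]

end LaurentSeries

/-- The place defined by an embedding into the field of Laurent series. -/
noncomputable def Place.ofAlgHom {k F : Type*} [Field k] [Field F] [Algebra k F]
    (φ : F →ₐ[k] LaurentSeries k) {g : F} (hg : Valued.v (φ g) = WithZero.exp (-1 : ℤ)) :
    Place k F where
  val := Valued.v.comap (φ : F →+* LaurentSeries k)
  surjective c := by
    by_cases hc : c = 0
    · exact ⟨0, by simp [hc]⟩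
    · refine ⟨g ^ (-WithZero.log c), ?_⟩
      rw [Valuation.comap_apply, RingHom.coe_coe, map_zpow₀, map_zpow₀, hg, ← WithZero.exp_zsmul,
        smul_eq_mul, mul_neg, mul_one, neg_neg, WithZero.exp_log hc]
  trivial c hc := by
    rw [Valuation.comap_apply, RingHom.coe_coe, AlgHom.commutes]
    exact LaurentSeries.valuation_algebraMap hc

/-! ### Existence of places over affine points -/

namespace GenusTwoCurve

variable {K : Type*} [Field K] (H : GenusTwoCurve K)

theorem isChart_affine : Place.IsChart H.x H.y H.hBar H.fBar :=
  ⟨H.y_equation, H.exists_rep, H.aeval_x_injective⟩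

/-- A Laurent series solution of the equation of the curve with nonconstant first coordinate gives
an embedding of the function field. -/
theorem exists_algHom_laurentSeries {x₀ y₀ : LaurentSeries (AlgebraicClosure K)}
    {a : AlgebraicClosure K} {n : ℤ} (hn : n ≠ 0)
    (hv : Valued.v (x₀ - algebraMap (AlgebraicClosure K) _ a) = WithZero.exp n)
    (hy : y₀ ^ 2 + aeval x₀ H.hBar * y₀ = aeval x₀ H.fBar) :
    ∃ φ : H.FunctionField →ₐ[AlgebraicClosure K] LaurentSeries (AlgebraicClosure K),
      φ H.x = x₀ ∧ φ H.y = y₀ := by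
  refine H.exists_algHom x₀ y₀ ?_ hy
  have h1 : Transcendental (AlgebraicClosure K) (x₀ - algebraMap (AlgebraicClosure K) _ a) := by
    refine LaurentSeries.transcendental_of_valuation_ne_one ?_ ?_
    · intro h0
      rw [h0, map_zero] at hv
      exact WithZero.exp_ne_zero hv.symm
    · rw [hv, ← WithZero.exp_zero, Ne, WithZero.exp_inj]
      exact hn
  exact fun h => h1 (h.sub (isAlgebraic_algebraMap a))

theorem constantCoeff_aeval {k : Type*} [Field k] (s : PowerSeries k) (p : k[X]) :
    (aeval s p).constantCoeff = p.eval s.constantCoeff := by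
  have := p.hom_eval₂ (algebraMap _ _) (PowerSeries.constantCoeff (R := k)) s
  rw [← aeval_def] at this
  rw [this]
  simp [eval₂_eq_eval_map]

/-- There is a place over every affine point that is not fixed by the hyperelliptic involution. -/
theorem exists_isAffinePoint {a b : AlgebraicClosure K}
    (hb : b ^ 2 + H.hBar.eval a * b = H.fBar.eval a) (hb' : 2 * b + H.hBar.eval a ≠ 0) :
    ∃ P : H.Point, H.IsAffinePoint P a b := by
  -- The parameter is x - a itself, and y is expanded in it with constant term b.
  set s : PowerSeries (AlgebraicClosure K) := PowerSeries.C a + PowerSeries.X with hs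
  have hc : s.constantCoeff = a := by simp [hs]
  obtain ⟨e, he, heb⟩ := exists_powerSeries_root (aeval s H.hBar) (aeval s H.fBar)
    b (by rw [constantCoeff_aeval, constantCoeff_aeval, hc, hb])
    (by rwa [constantCoeff_aeval, hc])
  have hv : Valued.v (HahnSeries.ofPowerSeries ℤ _ s - algebraMap (AlgebraicClosure K) _ a) =
      WithZero.exp (-1 : ℤ) := by
    rw [hs, map_add, LaurentSeries.coe_C_eq, add_sub_cancel_left, LaurentSeries.valuation_coe_X]
  obtain ⟨φ, hφx, hφy⟩ := H.exists_algHom_laurentSeries (y₀ := HahnSeries.ofPowerSeries ℤ _ e)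
    (by norm_num) hv (by
      rw [LaurentSeries.aeval_coe, LaurentSeries.aeval_coe, ← map_pow, ← map_mul, ← map_add, he])
  have hφa : Valued.v (φ (H.x - algebraMap (AlgebraicClosure K) _ a)) = WithZero.exp (-1 : ℤ) := by
    rw [map_sub, hφx, AlgHom.commutes, hv]
  refine ⟨Place.ofAlgHom φ hφa, ?_, ?_⟩
  · change Valued.v (φ _) < 1
    rw [hφa, ← WithZero.exp_zero, WithZero.exp_lt_exp]
    norm_num
  · change Valued.v (φ _) < 1
    rw [map_sub, hφy, AlgHom.commutes]
    have := LaurentSeries.valuation_coe_lt_one (s := e - PowerSeries.C b) (by simp [heb])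
    rwa [map_sub, LaurentSeries.coe_C_eq] at this

/-! ### The discriminant and the ramified places -/

/-- The discriminant `h² + 4 f`. -/
noncomputable def disc : (AlgebraicClosure K)[X] := H.hBar ^ 2 + 4 * H.fBar

theorem disc_eq : aeval H.x H.disc = (2 * H.y + aeval H.x H.hBar) ^ 2 := by
  rw [disc, map_add, map_mul, map_pow, map_ofNat, ← H.y_equation]
  ring

/-- At a multiple root a of the discriminant, the point (a, -h(a)/2) would be singular. -/
theorem eval_derivative_disc_ne_zero [CharZero K] {a : AlgebraicClosure K}
    (ha : H.disc.eval a = 0) : H.disc.derivative.eval a ≠ 0 := by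
  intro ha'
  simp only [disc, eval_add, eval_mul, eval_pow, eval_ofNat, derivative_add, derivative_mul,
    derivative_pow, derivative_ofNat, eval_C, zero_mul, zero_add,
    Nat.cast_ofNat, Nat.add_one_sub_one, pow_one] at ha ha'
  refine H.smooth_affine a (-H.hBar.eval a / 2) ?_ ⟨?_, ?_⟩
  · rw [← eval_map_algebraMap, ← eval_map_algebraMap]
    linear_combination -ha / 4
  · rw [← eval_map_algebraMap]
    ring
  · rw [← eval_map_algebraMap, ← eval_map_algebraMap, ← derivative_map, ← derivative_map]
    linear_combination -ha' / 4

theorem disc_eq_X_sub_C_mul [CharZero K] {a : AlgebraicClosure K} (ha : H.disc.eval a = 0) :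
    ∃ q, H.disc = (X - C a) * q ∧ q.eval a ≠ 0 := by
  obtain ⟨q, hq⟩ := dvd_iff_isRoot.2 ha
  refine ⟨q, hq, fun h0 => H.eval_derivative_disc_ne_zero ha ?_⟩
  rw [hq]
  simp [h0]

/-- There is a place over every value of `x`. -/
theorem exists_val_x_sub_lt [CharZero K] (a : AlgebraicClosure K) :
    ∃ P : H.Point, P.val (H.x - algebraMap (AlgebraicClosure K) H.FunctionField a) < 1 := by
  by_cases ha : H.disc.eval a = 0
  · obtain ⟨q, hq, hqa⟩ := H.disc_eq_X_sub_C_mul ha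
    obtain ⟨c, hc⟩ := IsAlgClosed.exists_pow_nat_eq (q.eval a) (n := 2) (by norm_num)
    have hc0 : c ≠ 0 := by
      rintro rfl
      exact hqa (by rw [← hc]; simp)
    -- At a branch point x - a has order 2, so x is set to a + T². The discriminant becomes T² q(x)
    -- with q(a) ≠ 0, which is the square of T e for a power series root e of q(x). Then 2y + h = T
    -- e serves as uniformizer.
    set s : PowerSeries (AlgebraicClosure K) := PowerSeries.C a + PowerSeries.X ^ 2 with hs
    have hsc : s.constantCoeff = a := by simp [hs]
    obtain ⟨e, he, hec⟩ := exists_powerSeries_root 0 (aeval s q) c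
      (by rw [constantCoeff_aeval, hsc]; simp [hc]) (by simpa using hc0)
    rw [zero_mul, add_zero] at he
    have hv : Valued.v (HahnSeries.ofPowerSeries ℤ _ s - algebraMap (AlgebraicClosure K) _ a) =
        WithZero.exp (-2 : ℤ) := by
      rw [hs, map_add, LaurentSeries.coe_C_eq, add_sub_cancel_left, map_pow, map_pow,
        LaurentSeries.valuation_coe_X, ← WithZero.exp_nsmul]
      norm_num
    have hD : aeval s H.disc = (PowerSeries.X * e) ^ 2 := by
      rw [hq, map_mul, mul_pow, he, map_sub, aeval_X, aeval_C]
      congr 1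
      rw [hs]
      exact add_sub_cancel_left _ _
    have : CharZero (LaurentSeries (AlgebraicClosure K)) :=
      charZero_of_injective_algebraMap (algebraMap (AlgebraicClosure K) _).injective
    have hD' := congrArg (HahnSeries.ofPowerSeries ℤ (AlgebraicClosure K)) hD
    rw [← LaurentSeries.aeval_coe, map_pow, disc, map_add, map_mul, map_pow, map_ofNat] at hD'
    obtain ⟨φ, hφx, hφy⟩ := H.exists_algHom_laurentSeries
      (y₀ := (HahnSeries.ofPowerSeries ℤ _ (PowerSeries.X * e) -
        aeval (HahnSeries.ofPowerSeries ℤ _ s) H.hBar) / 2) (by norm_num) hv (by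
        linear_combination (-1 / 4 : LaurentSeries (AlgebraicClosure K)) * hD')
    have hφg : Valued.v (φ (2 * H.y + aeval H.x H.hBar)) = WithZero.exp (-1 : ℤ) := by
      rw [map_add, map_mul, map_ofNat, hφy, ← aeval_algHom_apply, hφx,
        mul_div_cancel₀ _ two_ne_zero, sub_add_cancel, map_mul, map_mul, LaurentSeries.valuation_coe_X,
        LaurentSeries.valuation_coe_eq_one (by rwa [hec]), mul_one]
    refine ⟨Place.ofAlgHom φ hφg, ?_⟩
    change Valued.v (φ _) < 1
    rw [map_sub, hφx, AlgHom.commutes, hv, ← WithZero.exp_zero, WithZero.exp_lt_exp]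
    norm_num
  · obtain ⟨c, hc⟩ := IsAlgClosed.exists_pow_nat_eq (H.disc.eval a) (n := 2) (by norm_num)
    have hc0 : c ≠ 0 := by
      rintro rfl
      exact ha (by rw [← hc]; simp)
    have hc' : c ^ 2 = H.hBar.eval a ^ 2 + 4 * H.fBar.eval a := by
      rw [hc]
      simp [disc]
    obtain ⟨P, hP⟩ := H.exists_isAffinePoint (a := a) (b := (c - H.hBar.eval a) / 2)
      (by linear_combination hc' / 4) (by convert hc0 using 1; ring)
    exact ⟨P, hP.1⟩

/-! ### The chart at infinity -/

/-- The equation at infinity: the polynomial `h₃ + h₂ z + ⋯`. -/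
noncomputable abbrev hInf : (AlgebraicClosure K)[X] := reflect 3 H.hBar

/-- The equation at infinity: the polynomial `f₆ + f₅ z + ⋯`. -/
noncomputable abbrev fInf : (AlgebraicClosure K)[X] := reflect 6 H.fBar

theorem natDegree_hBar_le : H.hBar.natDegree ≤ 3 := natDegree_map_le.trans H.natDegree_h_le

theorem natDegree_fBar_le : H.fBar.natDegree ≤ 6 := natDegree_map_le.trans H.natDegree_f_le

theorem x_ne_zero : H.x ≠ 0 := by
  simpa using H.isChart_affine.sub_ne_zero 0

theorem isChart_infinity : Place.IsChart H.x⁻¹ (H.y * H.x⁻¹ ^ 3) H.hInf H.fInf := by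
  have hx := inv_ne_zero H.x_ne_zero
  have hinj : ∀ A : (AlgebraicClosure K)[X], aeval H.x⁻¹ A = 0 → A = 0 := fun A hA => by
    have h := aeval_inv_mul_pow H.x_ne_zero (le_refl A.natDegree)
    rw [hA, zero_mul] at h
    have := H.aeval_x_injective (h.symm.trans (map_zero (aeval H.x)).symm)
    simpa using this
  refine ⟨?_, fun g => ?_, (injective_iff_map_eq_zero _).2 hinj⟩
  · rw [← aeval_inv_mul_pow hx H.natDegree_hBar_le, ← aeval_inv_mul_pow hx H.natDegree_fBar_le,
      inv_inv, ← H.y_equation]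
    ring
  · obtain ⟨A, B, D, hD, h⟩ := H.exists_rep g
    set N := max A.natDegree (max (B.natDegree) D.natDegree)
    have hA : A.natDegree ≤ N + 3 := (le_max_left _ _).trans (Nat.le_add_right _ _)
    have hB : B.natDegree ≤ N := (le_max_left _ _).trans (le_max_right _ _)
    have hD' : D.natDegree ≤ N + 3 :=
      ((le_max_right _ _).trans (le_max_right _ _)).trans (Nat.le_add_right _ _)
    -- Multiplying the normal form by x⁻¹ to the power N + 3 spends three of these factors on
    -- turning y into y/x³, so `B` is reversed only in degree N.
    refine ⟨reflect (N + 3) A, reflect N B, reflect (N + 3) D, by simpa using hD, ?_⟩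
    rw [← aeval_inv_mul_pow hx hA, ← aeval_inv_mul_pow hx hB, ← aeval_inv_mul_pow hx hD', inv_inv]
    linear_combination H.x⁻¹ ^ (N + 3) * h

/-- The point `P` lies at infinity and the function `y / x³` has there the value `b`. -/
def IsInfinitePoint (P : H.Point) (b : AlgebraicClosure K) : Prop :=
  P.val (H.x⁻¹ - algebraMap (AlgebraicClosure K) H.FunctionField 0) < 1 ∧
    P.val (H.y * H.x⁻¹ ^ 3 - algebraMap (AlgebraicClosure K) H.FunctionField b) < 1

theorem isAtInfinity_iff (P : H.Point) : H.IsAtInfinity P ↔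
    P.val (H.x⁻¹ - algebraMap (AlgebraicClosure K) H.FunctionField 0) < 1 := by
  have hx : P.val H.x ≠ 0 := (Valuation.ne_zero_iff _).2 H.x_ne_zero
  rw [IsAtInfinity, map_zero, sub_zero, map_inv₀, inv_lt_one₀ (zero_lt_iff.2 hx)]

/-- There is a place over every point at infinity that is not fixed by the hyperelliptic
involution. -/
theorem exists_isInfinitePoint {b : AlgebraicClosure K}
    (hb : b ^ 2 + H.hInf.eval 0 * b = H.fInf.eval 0) (hb' : 2 * b + H.hInf.eval 0 ≠ 0) :
    ∃ P : H.Point, H.IsInfinitePoint P b := by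
  obtain ⟨e, he, heb⟩ := exists_powerSeries_root (aeval PowerSeries.X H.hInf)
    (aeval PowerSeries.X H.fInf) b (by simpa [constantCoeff_aeval] using hb)
    (by simpa [constantCoeff_aeval] using hb')
  set z := HahnSeries.ofPowerSeries ℤ (AlgebraicClosure K) PowerSeries.X with hz
  have hvz : Valued.v z = WithZero.exp (-1 : ℤ) := LaurentSeries.valuation_coe_X
  have hz0 : z ≠ 0 := by
    intro h0
    rw [h0, map_zero] at hvz
    exact WithZero.exp_ne_zero hvz.symm
  have hv : Valued.v (z⁻¹ - algebraMap (AlgebraicClosure K) (LaurentSeries _) 0) =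
      WithZero.exp (1 : ℤ) := by
    rw [map_zero, sub_zero, map_inv₀, hvz, ← WithZero.exp_neg, neg_neg]
  have he' := congrArg (HahnSeries.ofPowerSeries ℤ (AlgebraicClosure K)) he
  rw [map_add, map_mul, map_pow, ← LaurentSeries.aeval_coe, ← LaurentSeries.aeval_coe, ← hz,
    ← aeval_inv_mul_pow hz0 H.natDegree_hBar_le, ← aeval_inv_mul_pow hz0 H.natDegree_fBar_le] at he'
  obtain ⟨φ, hφx, hφy⟩ := H.exists_algHom_laurentSeries
    (y₀ := HahnSeries.ofPowerSeries ℤ _ e * z⁻¹ ^ 3) (by norm_num) hv (by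
      refine mul_right_cancel₀ (pow_ne_zero 6 hz0) ?_
      rw [← he']
      field_simp)
  have hφa : Valued.v (φ H.x⁻¹) = WithZero.exp (-1 : ℤ) := by
    rw [map_inv₀, hφx, inv_inv, hvz]
  refine ⟨Place.ofAlgHom φ hφa, ?_, ?_⟩
  · change Valued.v (φ _) < 1
    rw [map_zero, sub_zero, hφa, ← WithZero.exp_zero, WithZero.exp_lt_exp]
    norm_num
  · change Valued.v (φ _) < 1
    rw [map_sub, map_mul, map_pow, map_inv₀, hφy, hφx, AlgHom.commutes, mul_assoc, ← mul_pow,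
      inv_inv, inv_mul_cancel₀ hz0, one_pow, mul_one]
    have := LaurentSeries.valuation_coe_lt_one (s := e - PowerSeries.C b) (by simp [heb])
    rwa [map_sub, LaurentSeries.coe_C_eq] at this

/-! ### Functions with poles of order at most two at infinity -/

/-- The image of a point under the hyperelliptic involution. -/
noncomputable def conj (P : H.Point) : H.Point :=
  Place.transport H.involution.toRingEquiv (RingEquiv.refl _) (fun c => H.involution.commutes c) P

theorem conj_val (P : H.Point) (g : H.FunctionField) :
    (H.conj P).val g = P.val (H.involution g) := by
  have h : H.involution.toRingEquiv.symm g = H.involution g := by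
    rw [RingEquiv.symm_apply_eq]
    exact (H.involution_involution g).symm
  change P.val (H.involution.toRingEquiv.symm g) = _
  rw [h]

theorem conj_ord (P : H.Point) (g : H.FunctionField) :
    (H.conj P).ord g = P.ord (H.involution g) := by
  rw [Place.ord, conj_val, Place.ord]

theorem isAtInfinity_conj (P : H.Point) : H.IsAtInfinity (H.conj P) ↔ H.IsAtInfinity P := by
  rw [IsAtInfinity, IsAtInfinity, conj_val, involution_x]

theorem isAffinePoint_conj {P : H.Point} {a b : AlgebraicClosure K} (h : H.IsAffinePoint P a b) :
    H.IsAffinePoint (H.conj P) a (-b - H.hBar.eval a) := by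
  refine ⟨?_, ?_⟩
  · rw [conj_val, map_sub, involution_x, AlgEquiv.commutes]
    exact h.1
  · rw [conj_val, map_sub H.involution, involution_y, AlgEquiv.commutes, map_sub (algebraMap _ _),
      map_neg (algebraMap _ _),
      show -H.y - aeval H.x H.hBar - (-algebraMap (AlgebraicClosure K) H.FunctionField b -
        algebraMap _ _ (H.hBar.eval a)) = -((H.y - algebraMap _ _ b) +
        (aeval H.x H.hBar - algebraMap _ _ (H.hBar.eval a))) by ring, Valuation.map_neg]
    exact P.val.map_add_lt h.2 (P.val_aeval_sub_eval_lt h.1 _)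

/-- At a place over a root a of `D`, coprimality makes B(x) a unit, so regularity of `S` forces 2y +
h to vanish at least as much as D(x). Its square, the discriminant, then vanishes at least as much
as (x - a)². But the discriminant has at most a simple zero at a. -/
theorem isUnit_denominator_of_regular [CharZero K] {B D : (AlgebraicClosure K)[X]}
    (hBD : IsCoprime B D) {S : H.FunctionField}
    (hS : aeval H.x D * S = aeval H.x B * (2 * H.y + aeval H.x H.hBar))
    (hreg : ∀ P : H.Point, ¬ H.IsAtInfinity P → P.val S ≤ 1) : IsUnit D := by
  rw [Polynomial.isUnit_iff_degree_eq_zero]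
  by_contra hdeg
  obtain ⟨a, ha⟩ := IsAlgClosed.exists_root D hdeg
  obtain ⟨P, hP⟩ := H.exists_val_x_sub_lt a
  have hB : B.eval a ≠ 0 := by
    intro hB
    obtain ⟨r, s, hrs⟩ := hBD
    have := congrArg (eval a) hrs
    simp [hB, ha.eq_zero] at this
  have hS1 : P.val S ≤ 1 := hreg P (not_lt.2 (P.val_le_of_sub_lt hP))
  have h1 : P.val (aeval H.x H.disc) ≤ P.val (aeval H.x D) ^ 2 := by
    rw [disc_eq, map_pow]
    gcongr
    have := congrArg P.val hS
    rw [map_mul, map_mul, P.val_aeval_eq_one hP hB, one_mul] at this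
    rw [← this]
    exact mul_le_of_le_one_right' hS1
  set e := P.val (H.x - algebraMap (AlgebraicClosure K) H.FunctionField a) with he
  have he0 : 0 < e := zero_lt_iff.2 ((Valuation.ne_zero_iff _).2 (H.isChart_affine.sub_ne_zero a))
  have h2 : P.val (aeval H.x D) ≤ e := by
    obtain ⟨q, hq⟩ := dvd_iff_isRoot.2 ha
    rw [hq, map_mul, map_mul, map_sub, aeval_X, aeval_C]
    exact mul_le_of_le_one_right' (P.val_aeval_le (P.val_le_of_sub_lt hP) q)
  have h3 : P.val (aeval H.x H.disc) ≤ e ^ 2 := h1.trans (by gcongr)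
  have h4 : e ^ 2 < e := by
    rw [sq]
    exact mul_lt_of_lt_one_left he0 hP
  by_cases hd : H.disc.eval a = 0
  · obtain ⟨q, hq, hqa⟩ := H.disc_eq_X_sub_C_mul hd
    rw [hq, map_mul, map_mul, P.val_aeval_eq_one hP hqa, mul_one, map_sub, aeval_X, aeval_C] at h3
    exact absurd h4 (not_lt.2 h3)
  · rw [P.val_aeval_eq_one hP hd] at h3
    exact absurd (h4.trans hP) (not_lt.2 h3)

/-- A function whose only poles are poles at infinity of order at most two is a polynomial in `x`,
hence fixed by the hyperelliptic involution. -/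
theorem involution_eq_self [CharZero K] (hdeg : H.disc.natDegree = 6)
    (hinf : ∃ P : H.Point, H.IsAtInfinity P) {g : H.FunctionField}
    (h1 : ∀ P : H.Point, ¬ H.IsAtInfinity P → P.val g ≤ 1)
    (h2 : ∀ P : H.Point, H.IsAtInfinity P → P.val g ≤ P.val H.x ^ 2) :
    H.involution g = g := by
  obtain ⟨A, B, D, hD, hg⟩ := H.exists_rep g
  obtain ⟨d, B, D, hd, hBD, rfl, rfl⟩ := exists_isCoprime_of_ne_zero B D (Or.inr hD)
  have hD0 : D ≠ 0 := right_ne_zero_of_mul hD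
  have hd0 := H.isChart_affine.aeval_ne_zero hd
  set S := g - H.involution g with hS
  -- Passing to the difference of g and its conjugate eliminates the numerator `A` and leaves a
  -- multiple of 2y + h.
  have hDS : aeval H.x D * S = aeval H.x B * (2 * H.y + aeval H.x H.hBar) := by
    refine mul_left_cancel₀ hd0 ?_
    have hg' := congrArg H.involution hg
    simp only [map_mul, map_add, involution_aeval, involution_y] at hg hg'
    linear_combination hg - hg'
  have hu : IsUnit D := H.isUnit_denominator_of_regular hBD hDS fun P hP =>
    P.val.map_sub_le (h1 P hP) (by
      rw [← conj_val]
      exact h1 _ (by rwa [isAtInfinity_conj]))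
  suffices hS0 : S = 0 from (sub_eq_zero.1 hS0).symm
  by_contra hS0
  have hB : B ≠ 0 := by
    rintro rfl
    rw [map_zero, zero_mul] at hDS
    exact (mul_ne_zero (H.isChart_affine.aeval_ne_zero hD0) hS0) hDS
  obtain ⟨P, hP⟩ := hinf
  have hx : 1 < P.val H.x := hP
  have h3 : P.val S ≤ P.val H.x ^ 2 := P.val.map_sub_le (h2 P hP) (by
    rw [← conj_val, ← H.involution_x, ← conj_val]
    exact h2 _ (by rwa [isAtInfinity_conj]))
  -- The square of 2y + h is a polynomial of degree exactly 6 in x, so 2y + h has three times the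
  -- pole order of x.
  have h4 : P.val (2 * H.y + aeval H.x H.hBar) = P.val H.x ^ 3 := by
    have hdisc : H.disc ≠ 0 := by
      rintro h0
      rw [h0] at hdeg
      simp at hdeg
    have := P.val_aeval_of_one_lt hx hdisc
    rw [disc_eq, hdeg, map_pow, show (6 : ℕ) = 3 * 2 from rfl, pow_mul] at this
    exact (pow_left_inj₀ zero_le zero_le two_ne_zero).1 this
  have h5 := congrArg P.val hDS
  rw [map_mul, map_mul, h4, P.val_aeval_of_one_lt hx hD0, P.val_aeval_of_one_lt hx hB,
    natDegree_eq_zero_of_isUnit hu, pow_zero, one_mul] at h5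
  have h6 : P.val H.x ^ 3 ≤ P.val S := by
    rw [h5]
    exact le_mul_of_one_le_left' (one_le_pow₀ hx.le)
  exact absurd (h6.trans h3) (not_le.2 (pow_lt_pow_right₀ hx (by norm_num)))

/-- A principal divisor with no poles other than poles at infinity of order at most two is symmetric
under the hyperelliptic involution. -/
theorem apply_conj_of_mem_principal [CharZero K] (hdeg : H.disc.natDegree = 6)
    (hinf : ∃ P : H.Point, H.IsAtInfinity P) {E : Divisor (AlgebraicClosure K) H.FunctionField}
    (hE : E ∈ Divisor.principal (AlgebraicClosure K) H.FunctionField)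
    (h1 : ∀ P : H.Point, ¬ H.IsAtInfinity P → 0 ≤ E P)
    (h2 : ∀ P : H.Point, H.IsAtInfinity P → -2 ≤ E P) (P : H.Point) : E (H.conj P) = E P := by
  obtain ⟨g, hg0, hg⟩ := hE
  have hval : ∀ P : H.Point, P.val g = WithZero.exp (-E P) := fun P => by
    rw [hg, Place.ord, neg_neg, WithZero.exp_log ((Valuation.ne_zero_iff _).2 hg0)]
  have hinv : H.involution g = g := by
    refine H.involution_eq_self hdeg hinf (fun P hP => ?_) (fun P hP => ?_)
    · rw [hval, ← WithZero.exp_zero, WithZero.exp_le_exp]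
      linarith [h1 P hP]
    -- The pole order of x is a positive integer, so a pole of order at most 2 is bounded by that of
    -- x².
    · have hx : WithZero.exp (1 : ℤ) ≤ P.val H.x := by
        have hx : 1 < P.val H.x := hP
        obtain ⟨m, hm⟩ : ∃ m : ℤ, P.val H.x = WithZero.exp m :=
          ⟨_, (WithZero.exp_log (zero_lt_one.trans hx).ne').symm⟩
        rw [hm] at hx ⊢
        rw [← WithZero.exp_zero, WithZero.exp_lt_exp] at hx
        rw [WithZero.exp_le_exp]
        omega
      calc P.val g ≤ WithZero.exp (1 : ℤ) ^ 2 := by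
            rw [hval, ← WithZero.exp_nsmul, WithZero.exp_le_exp]
            have := h2 P hP
            simp only [nsmul_eq_mul, Nat.cast_ofNat, mul_one]
            linarith
        _ ≤ _ := by gcongr
  rw [hg, hg, conj_ord, hinv]

/-! ### The Galois action on points and their classes -/

/-- The action of the Galois group on the points. -/
noncomputable def galoisPoint (σ : AlgebraicClosure K ≃ₐ[K] AlgebraicClosure K) :
    H.Point ≃ H.Point :=
  Place.transportEquiv (H.galoisFunctionField σ) σ.toRingEquiv
    (H.galoisFunctionField_algebraMap σ)

theorem galoisPoint_val (σ : AlgebraicClosure K ≃ₐ[K] AlgebraicClosure K) (v : H.Point)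
    {g : H.FunctionField} (hg : H.galoisFunctionField σ g = g) :
    (H.galoisPoint σ v).val g = v.val g := by
  change v.val ((H.galoisFunctionField σ).symm g) = v.val g
  congr 1
  rw [RingEquiv.symm_apply_eq, hg]

theorem isAffinePoint_galoisPoint (σ : AlgebraicClosure K ≃ₐ[K] AlgebraicClosure K) {v : H.Point}
    {a b : AlgebraicClosure K} (ha : σ a = a) (hb : σ b = b) (h : H.IsAffinePoint v a b) :
    H.IsAffinePoint (H.galoisPoint σ v) a b := by
  refine ⟨?_, ?_⟩
  · rw [galoisPoint_val]
    · exact h.1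
    · rw [map_sub, galoisFunctionField_x, galoisFunctionField_algebraMap]
      exact congrArg (fun c => H.x - algebraMap (AlgebraicClosure K) _ c) ha
  · rw [galoisPoint_val]
    · exact h.2
    · rw [map_sub, galoisFunctionField_y, galoisFunctionField_algebraMap]
      exact congrArg (fun c => H.y - algebraMap (AlgebraicClosure K) _ c) hb

theorem isInfinitePoint_galoisPoint (σ : AlgebraicClosure K ≃ₐ[K] AlgebraicClosure K) {v : H.Point}
    {b : AlgebraicClosure K} (hb : σ b = b) (h : H.IsInfinitePoint v b) :
    H.IsInfinitePoint (H.galoisPoint σ v) b := by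
  refine ⟨?_, ?_⟩
  · rw [galoisPoint_val]
    · exact h.1
    · rw [map_zero, sub_zero, map_inv₀, galoisFunctionField_x]
  · rw [galoisPoint_val]
    · exact h.2
    · rw [map_sub, map_mul, map_pow, map_inv₀, galoisFunctionField_x, galoisFunctionField_y,
        galoisFunctionField_algebraMap]
      exact congrArg (fun c => H.y * H.x⁻¹ ^ 3 - algebraMap (AlgebraicClosure K) _ c) hb

/-- The class of a point, as a divisor. -/
noncomputable def pointClass (P : H.Point) : H.DivisorClassGroup :=
  QuotientAddGroup.mk (Finsupp.single P 1)

theorem galoisClass_pointClass (σ : AlgebraicClosure K ≃ₐ[K] AlgebraicClosure K) (v : H.Point) :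
    H.galoisClass σ (H.pointClass v) = H.pointClass (H.galoisPoint σ v) := by
  change QuotientAddGroup.mk (Finsupp.equivMapDomain (H.galoisPoint σ) (Finsupp.single v 1)) = _
  rw [Finsupp.equivMapDomain_single]
  rfl

end GenusTwoCurve

theorem Place.ord_eq_zero {k F : Type*} [Field k] [Field F] [Algebra k F] {v : Place k F} {g : F}
    (h : v.val g = 1) : v.ord g = 0 := by
  rw [Place.ord, h, WithZero.log_one, neg_zero]

theorem Place.ord_pow {k F : Type*} [Field k] [Field F] [Algebra k F] (v : Place k F) (g : F)
    (n : ℕ) : v.ord (g ^ n) = n * v.ord g := by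
  rw [Place.ord, Place.ord, map_pow, WithZero.log_pow]
  simp

theorem Place.IsChart.ord_sub_eq {k F : Type*} [Field k] [Field F] [Algebra k F] {t w : F}
    {p q : k[X]} (h : Place.IsChart t w p q) {a b : k} (hab : 2 * b + p.eval a ≠ 0) (v : Place k F)
    (ht : v.val (t - algebraMap k F a) < 1) (hw : v.val (w - algebraMap k F b) < 1) :
    v.ord (t - algebraMap k F a) = 1 := by
  rw [Place.ord, h.val_sub_eq hab v ht hw, WithZero.log_exp]
  norm_num

/-! ### The six points used on the curve -/

namespace CurveC70

open GenusTwoCurve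

local notation "k" => AlgebraicClosure ℚ

theorem hBar_eq : curveC70.hBar = 2 * X ^ 3 - 3 * X ^ 2 - 41 * X + 110 := by
  simp [hBar, curveC70]

theorem fBar_eq : curveC70.fBar = X ^ 3 - 51 * X ^ 2 + 425 * X + 179 := by
  simp [fBar, curveC70]

theorem hInf_eq : curveC70.hInf = 2 - 3 * X - 41 * X ^ 2 + 110 * X ^ 3 := by
  rw [hInf, hBar_eq]
  have h : (2 * X ^ 3 - 3 * X ^ 2 - 41 * X + 110 : k[X]) =
      C 2 * X ^ 3 - C 3 * X ^ 2 - C 41 * X ^ 1 + C 110 * X ^ 0 := by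
    simp only [map_ofNat]; ring
  rw [h, reflect_add, reflect_sub, reflect_sub, reflect_C_mul_X_pow, reflect_C_mul_X_pow,
    reflect_C_mul_X_pow, reflect_C_mul_X_pow]
  simp [revAt_le, map_ofNat]

theorem fInf_eq : curveC70.fInf = X ^ 3 - 51 * X ^ 4 + 425 * X ^ 5 + 179 * X ^ 6 := by
  rw [fInf, fBar_eq]
  have h : (X ^ 3 - 51 * X ^ 2 + 425 * X + 179 : k[X]) =
      C 1 * X ^ 3 - C 51 * X ^ 2 + C 425 * X ^ 1 + C 179 * X ^ 0 := by
    simp only [map_ofNat, map_one]; ring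
  rw [h, reflect_add, reflect_add, reflect_sub, reflect_C_mul_X_pow, reflect_C_mul_X_pow,
    reflect_C_mul_X_pow, reflect_C_mul_X_pow]
  simp [revAt_le, map_ofNat]

theorem natDegree_disc : curveC70.disc.natDegree = 6 := by
  have h : curveC70.disc = 4 * X ^ 6 - 12 * X ^ 5 - 155 * X ^ 4 + 690 * X ^ 3 + 817 * X ^ 2
      - 7320 * X + 12816 := by
    rw [disc, hBar_eq, fBar_eq]; ring
  rw [h]
  compute_degree!

/-- The points of the curve with `x = 2` or `x = 4` and the points at infinity. -/
structure Points where
  A : curveC70.Point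
  A' : curveC70.Point
  B : curveC70.Point
  B' : curveC70.Point
  P : curveC70.Point
  M : curveC70.Point
  isAffinePoint_A : curveC70.IsAffinePoint A 2 17
  isAffinePoint_A' : curveC70.IsAffinePoint A' 2 (-49)
  isAffinePoint_B : curveC70.IsAffinePoint B 4 23
  isAffinePoint_B' : curveC70.IsAffinePoint B' 4 (-49)
  isInfinitePoint_P : curveC70.IsInfinitePoint P 0
  isInfinitePoint_M : curveC70.IsInfinitePoint M (-2)

/-- Since h(2) = 32 and h(4) = 26, the conjugates of (2, 17) and (4, 23) both have y = -49. At
infinity the equation is w² + 2w = 0. None of the six points is fixed by the involution. -/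
theorem nonempty_points : Nonempty Points := by
  have h : ∀ a b : k, b ^ 2 + curveC70.hBar.eval a * b = curveC70.fBar.eval a →
      2 * b + curveC70.hBar.eval a ≠ 0 → ∃ P, curveC70.IsAffinePoint P a b :=
    fun a b h1 h2 => curveC70.exists_isAffinePoint h1 h2
  have h' : ∀ b : k, b ^ 2 + curveC70.hInf.eval 0 * b = curveC70.fInf.eval 0 →
      2 * b + curveC70.hInf.eval 0 ≠ 0 → ∃ P, curveC70.IsInfinitePoint P b :=
    fun b h1 h2 => curveC70.exists_isInfinitePoint h1 h2
  rw [hBar_eq, fBar_eq] at h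
  rw [hInf_eq, fInf_eq] at h'
  obtain ⟨A, hA⟩ := h 2 17 (by norm_num) (by norm_num)
  obtain ⟨A', hA'⟩ := h 2 (-49) (by norm_num) (by norm_num)
  obtain ⟨B, hB⟩ := h 4 23 (by norm_num) (by norm_num)
  obtain ⟨B', hB'⟩ := h 4 (-49) (by norm_num) (by norm_num)
  obtain ⟨P, hP⟩ := h' 0 (by norm_num) (by norm_num)
  obtain ⟨M, hM⟩ := h' (-2) (by norm_num) (by norm_num)
  exact ⟨⟨A, A', B, B', P, M, hA, hA', hB, hB', hP, hM⟩⟩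

theorem eq_of_isAffinePoint {a b : k} (hab : 2 * b + curveC70.hBar.eval a ≠ 0)
    {u v : curveC70.Point} (hu : curveC70.IsAffinePoint u a b) (hv : curveC70.IsAffinePoint v a b) :
    u = v :=
  curveC70.isChart_affine.unique hab hu.1 hu.2 hv.1 hv.2

theorem isAffinePoint_or {a b : k} (hb : b ^ 2 + curveC70.hBar.eval a * b = curveC70.fBar.eval a)
    {v : curveC70.Point} (hv : v.val (curveC70.x - algebraMap k curveC70.FunctionField a) < 1) :
    curveC70.IsAffinePoint v a b ∨ curveC70.IsAffinePoint v a (-b - curveC70.hBar.eval a) :=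
  (curveC70.isChart_affine.val_sub_lt_or v hb hv).imp (⟨hv, ·⟩) (⟨hv, ·⟩)

theorem not_isAtInfinity_of_val_lt {a : k} {v : curveC70.Point}
    (hv : v.val (curveC70.x - algebraMap k curveC70.FunctionField a) < 1) :
    ¬ curveC70.IsAtInfinity v :=
  not_lt.2 (v.val_le_of_sub_lt hv)

theorem ne_of_val_lt {a a' : k} (haa : a ≠ a') {u v : curveC70.Point} {g : curveC70.FunctionField}
    (hu : u.val (g - algebraMap k curveC70.FunctionField a) < 1)
    (hv : v.val (g - algebraMap k curveC70.FunctionField a') < 1) : u ≠ v := by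
  rintro rfl
  exact haa (u.eq_of_val_sub_lt hu hv)

namespace Points

variable (S : Points)

theorem eq_A_or {v : curveC70.Point}
    (hv : v.val (curveC70.x - algebraMap k curveC70.FunctionField 2) < 1) :
    v = S.A ∨ v = S.A' := by
  refine (isAffinePoint_or (b := 17) (by rw [hBar_eq, fBar_eq]; norm_num) hv).imp
    (fun h => eq_of_isAffinePoint ?_ h S.isAffinePoint_A)
    (fun h => eq_of_isAffinePoint (b := -49) ?_ ?_ S.isAffinePoint_A')
  · rw [hBar_eq]; norm_num
  · rw [hBar_eq]; norm_num
  · convert h using 1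
    rw [hBar_eq]; norm_num

theorem eq_B_or {v : curveC70.Point}
    (hv : v.val (curveC70.x - algebraMap k curveC70.FunctionField 4) < 1) :
    v = S.B ∨ v = S.B' := by
  refine (isAffinePoint_or (b := 23) (by rw [hBar_eq, fBar_eq]; norm_num) hv).imp
    (fun h => eq_of_isAffinePoint ?_ h S.isAffinePoint_B)
    (fun h => eq_of_isAffinePoint (b := -49) ?_ ?_ S.isAffinePoint_B')
  · rw [hBar_eq]; norm_num
  · rw [hBar_eq]; norm_num
  · convert h using 1
    rw [hBar_eq]; norm_num

theorem isAtInfinity_P : curveC70.IsAtInfinity S.P :=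
  (curveC70.isAtInfinity_iff _).2 S.isInfinitePoint_P.1

theorem isAtInfinity_M : curveC70.IsAtInfinity S.M :=
  (curveC70.isAtInfinity_iff _).2 S.isInfinitePoint_M.1

theorem isAtInfinity_iff (v : curveC70.Point) : curveC70.IsAtInfinity v ↔ v = S.P ∨ v = S.M := by
  refine ⟨fun h => ?_, ?_⟩
  · have hv := (curveC70.isAtInfinity_iff v).1 h
    refine (curveC70.isChart_infinity.val_sub_lt_or v (b := 0)
      (by rw [hInf_eq, fInf_eq]; norm_num) hv).imp (fun h => ?_) (fun h => ?_)
    · exact curveC70.isChart_infinity.unique (by rw [hInf_eq]; norm_num) hv h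
        S.isInfinitePoint_P.1 S.isInfinitePoint_P.2
    · refine curveC70.isChart_infinity.unique (b := -2) (by rw [hInf_eq]; norm_num) hv ?_
        S.isInfinitePoint_M.1 S.isInfinitePoint_M.2
      convert h using 5
      rw [hInf_eq]; norm_num
  · rintro (rfl | rfl)
    · exact S.isAtInfinity_P
    · exact S.isAtInfinity_M

theorem A_ne_A' : S.A ≠ S.A' :=
  ne_of_val_lt (by norm_num) S.isAffinePoint_A.2 S.isAffinePoint_A'.2

theorem B_ne_B' : S.B ≠ S.B' :=
  ne_of_val_lt (by norm_num) S.isAffinePoint_B.2 S.isAffinePoint_B'.2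

theorem P_ne_M : S.P ≠ S.M :=
  ne_of_val_lt (by norm_num) S.isInfinitePoint_P.2 S.isInfinitePoint_M.2

theorem A_ne_B : S.A ≠ S.B :=
  ne_of_val_lt (by norm_num) S.isAffinePoint_A.1 S.isAffinePoint_B.1

theorem A_ne_B' : S.A ≠ S.B' :=
  ne_of_val_lt (by norm_num) S.isAffinePoint_A.1 S.isAffinePoint_B'.1

theorem A'_ne_B : S.A' ≠ S.B :=
  ne_of_val_lt (by norm_num) S.isAffinePoint_A'.1 S.isAffinePoint_B.1

theorem A'_ne_B' : S.A' ≠ S.B' :=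
  ne_of_val_lt (by norm_num) S.isAffinePoint_A'.1 S.isAffinePoint_B'.1

theorem ne_P_of_val_lt {a : k} {v : curveC70.Point}
    (hv : v.val (curveC70.x - algebraMap k curveC70.FunctionField a) < 1) : v ≠ S.P := by
  rintro rfl
  exact not_isAtInfinity_of_val_lt hv S.isAtInfinity_P

theorem ne_M_of_val_lt {a : k} {v : curveC70.Point}
    (hv : v.val (curveC70.x - algebraMap k curveC70.FunctionField a) < 1) : v ≠ S.M := by
  rintro rfl
  exact not_isAtInfinity_of_val_lt hv S.isAtInfinity_M

/-- The divisor with the given coefficients at the six points. -/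
noncomputable def divisor (a a' b b' p m : ℤ) : Divisor k curveC70.FunctionField :=
  Finsupp.single S.A a + Finsupp.single S.A' a' + Finsupp.single S.B b + Finsupp.single S.B' b' +
    Finsupp.single S.P p + Finsupp.single S.M m

variable (a a' b b' p m : ℤ)

theorem divisor_apply_A : S.divisor a a' b b' p m S.A = a := by
  simp [divisor, S.A_ne_A'.symm, S.A_ne_B.symm, S.A_ne_B'.symm,
    (S.ne_P_of_val_lt S.isAffinePoint_A.1).symm, (S.ne_M_of_val_lt S.isAffinePoint_A.1).symm]

theorem divisor_apply_A' : S.divisor a a' b b' p m S.A' = a' := by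
  simp [divisor, S.A_ne_A', S.A'_ne_B.symm, S.A'_ne_B'.symm,
    (S.ne_P_of_val_lt S.isAffinePoint_A'.1).symm, (S.ne_M_of_val_lt S.isAffinePoint_A'.1).symm]

theorem divisor_apply_B : S.divisor a a' b b' p m S.B = b := by
  simp [divisor, S.A_ne_B, S.A'_ne_B, S.B_ne_B'.symm,
    (S.ne_P_of_val_lt S.isAffinePoint_B.1).symm, (S.ne_M_of_val_lt S.isAffinePoint_B.1).symm]

theorem divisor_apply_B' : S.divisor a a' b b' p m S.B' = b' := by
  simp [divisor, S.A_ne_B', S.A'_ne_B', S.B_ne_B',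
    (S.ne_P_of_val_lt S.isAffinePoint_B'.1).symm, (S.ne_M_of_val_lt S.isAffinePoint_B'.1).symm]

theorem divisor_apply_P : S.divisor a a' b b' p m S.P = p := by
  simp [divisor, S.ne_P_of_val_lt S.isAffinePoint_A.1,
    S.ne_P_of_val_lt S.isAffinePoint_A'.1, S.ne_P_of_val_lt S.isAffinePoint_B.1,
    S.ne_P_of_val_lt S.isAffinePoint_B'.1, S.P_ne_M.symm]

theorem divisor_apply_M : S.divisor a a' b b' p m S.M = m := by
  simp [divisor, S.ne_M_of_val_lt S.isAffinePoint_A.1,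
    S.ne_M_of_val_lt S.isAffinePoint_A'.1, S.ne_M_of_val_lt S.isAffinePoint_B.1,
    S.ne_M_of_val_lt S.isAffinePoint_B'.1, S.P_ne_M]

theorem divisor_apply_of_ne {v : curveC70.Point} (h1 : v ≠ S.A) (h2 : v ≠ S.A') (h3 : v ≠ S.B)
    (h4 : v ≠ S.B') (h5 : v ≠ S.P) (h6 : v ≠ S.M) : S.divisor a a' b b' p m v = 0 := by
  simp [divisor, h1.symm, h2.symm, h3.symm, h4.symm, h5.symm, h6.symm]

variable {a a' b b' p m}

/-- The six points are all the places where x has a pole or takes the value 2 or 4, so elsewhere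
only x regular and x - 2, x - 4 units need be considered. -/
theorem divisor_mem_principal {g : curveC70.FunctionField} (hg : g ≠ 0)
    (hA : S.A.ord g = a) (hA' : S.A'.ord g = a') (hB : S.B.ord g = b) (hB' : S.B'.ord g = b')
    (hP : S.P.ord g = p) (hM : S.M.ord g = m)
    (hother : ∀ v : curveC70.Point, v.val curveC70.x ≤ 1 →
      v.val (curveC70.x - algebraMap k curveC70.FunctionField 2) = 1 →
      v.val (curveC70.x - algebraMap k curveC70.FunctionField 4) = 1 → v.ord g = 0) :
    S.divisor a a' b b' p m ∈ Divisor.principal k curveC70.FunctionField := by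
  refine ⟨g, hg, fun v => ?_⟩
  by_cases h1 : v = S.A
  · rw [h1, divisor_apply_A, hA]
  by_cases h2 : v = S.A'
  · rw [h2, divisor_apply_A', hA']
  by_cases h3 : v = S.B
  · rw [h3, divisor_apply_B, hB]
  by_cases h4 : v = S.B'
  · rw [h4, divisor_apply_B', hB']
  by_cases h5 : v = S.P
  · rw [h5, divisor_apply_P, hP]
  by_cases h6 : v = S.M
  · rw [h6, divisor_apply_M, hM]
  rw [S.divisor_apply_of_ne _ _ _ _ _ _ h1 h2 h3 h4 h5 h6]
  have hx : v.val curveC70.x ≤ 1 := by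
    have := mt (S.isAtInfinity_iff v).1 (by tauto)
    exact not_lt.1 this
  refine (hother v hx ?_ ?_).symm
  · refine le_antisymm (v.val.map_sub_le hx (v.val_algebraMap_le _)) (not_lt.1 fun h => ?_)
    rcases S.eq_A_or h with h | h <;> contradiction
  · refine le_antisymm (v.val.map_sub_le hx (v.val_algebraMap_le _)) (not_lt.1 fun h => ?_)
    rcases S.eq_B_or h with h | h <;> contradiction

end Points

/-! ### Orders of functions on the curve from their norms -/

theorem ord_eq_zero {v : curveC70.Point} {a b : k} (hv : curveC70.IsAffinePoint v a b)
    {α β : k[X]} (h : α.eval a + β.eval a * b ≠ 0) :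
    v.ord (aeval curveC70.x α + aeval curveC70.x β * curveC70.y) = 0 :=
  Place.ord_eq_zero (Place.IsChart.val_eq_one v hv.1 hv.2 h)

/-- The function and its conjugate are both regular at an affine place, and their product is a unit
away from x = 2 and x = 4, so each is a unit. -/
theorem ord_eq_zero_of_norm {v : curveC70.Point} {α β : k[X]} {c : k} {i j : ℕ} (hc : c ≠ 0)
    (hN : α ^ 2 - α * β * curveC70.hBar - β ^ 2 * curveC70.fBar =
      C c * (X - 2) ^ i * (X - 4) ^ j) (hx : v.val curveC70.x ≤ 1)
    (h2 : v.val (curveC70.x - algebraMap k curveC70.FunctionField 2) = 1)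
    (h4 : v.val (curveC70.x - algebraMap k curveC70.FunctionField 4) = 1) :
    v.ord (aeval curveC70.x α + aeval curveC70.x β * curveC70.y) = 0 := by
  have h := congrArg v.val (curveC70.isChart_affine.mul_conj α β)
  have hy := curveC70.isChart_affine.val_le_one v hx
  have e2 : aeval curveC70.x (X - 2 : k[X]) = curveC70.x - algebraMap k _ 2 := by
    rw [map_sub, aeval_X, map_ofNat, map_ofNat]
  have e4 : aeval curveC70.x (X - 4 : k[X]) = curveC70.x - algebraMap k _ 4 := by
    rw [map_sub, aeval_X, map_ofNat, map_ofNat]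
  rw [hN, map_mul v.val, map_mul (aeval _), map_mul (aeval _), map_pow (aeval _),
    map_pow (aeval _), e2, e4, aeval_C, map_mul v.val, map_mul v.val, map_pow v.val,
    map_pow v.val, h2, h4, v.trivial c hc, one_pow, one_pow, one_mul, one_mul] at h
  have h5 : v.val (aeval curveC70.x α + aeval curveC70.x β * curveC70.y) ≤ 1 := by
    refine v.val.map_add_le (v.val_aeval_le hx _) ?_
    rw [map_mul]
    exact mul_le_one' (v.val_aeval_le hx _) hy
  have h6 : v.val (aeval curveC70.x α + aeval curveC70.x β *
      (-curveC70.y - aeval curveC70.x curveC70.hBar)) ≤ 1 := by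
    refine v.val.map_add_le (v.val_aeval_le hx _) ?_
    rw [map_mul]
    refine mul_le_one' (v.val_aeval_le hx _) (v.val.map_sub_le ?_ (v.val_aeval_le hx _))
    rwa [Valuation.map_neg]
  refine Place.ord_eq_zero (le_antisymm h5 ?_)
  rw [← h]
  exact mul_le_of_le_one_right' h6

theorem ord_x_inv {v : curveC70.Point} {b : k} (hb : 2 * b + curveC70.hInf.eval 0 ≠ 0)
    (hv : curveC70.IsInfinitePoint v b) : v.ord curveC70.x⁻¹ = 1 := by
  simpa using curveC70.isChart_infinity.ord_sub_eq hb v hv.1 hv.2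

/-- Orders at infinity of functions, through the coordinates `1 / x` and `y / x³`. -/
theorem ord_infinity {v : curveC70.Point} {b : k} (hb : 2 * b + curveC70.hInf.eval 0 ≠ 0)
    (hv : curveC70.IsInfinitePoint v b) {g : curveC70.FunctionField} {α β N : k[X]} {n e : ℕ}
    (hg : g = curveC70.x ^ n * (aeval curveC70.x⁻¹ α + aeval curveC70.x⁻¹ β *
      (curveC70.y * curveC70.x⁻¹ ^ 3)))
    (hg0 : g ≠ 0)
    (hconj : α.eval 0 + β.eval 0 * (-b - curveC70.hInf.eval 0) ≠ 0)
    (hN : α ^ 2 - α * β * curveC70.hInf - β ^ 2 * curveC70.fInf = X ^ e * N)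
    (hN0 : N.eval 0 ≠ 0) : v.ord g = e - n := by
  rw [hg] at hg0 ⊢
  rw [v.ord_mul (left_ne_zero_of_mul hg0) (right_ne_zero_of_mul hg0), v.ord_pow,
    curveC70.isChart_infinity.ord_eq hb v hv.1 hv.2 hconj (by rw [map_zero, sub_zero]; exact hN)
      hN0,
    ← inv_inv curveC70.x, v.ord_inv, ord_x_inv hb hv]
  ring

theorem ord_infinity_of_ne_zero {v : curveC70.Point} {b : k}
    (hb : 2 * b + curveC70.hInf.eval 0 ≠ 0)
    (hv : curveC70.IsInfinitePoint v b) {g : curveC70.FunctionField} {α β : k[X]} {n : ℕ}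
    (hg : g = curveC70.x ^ n * (aeval curveC70.x⁻¹ α + aeval curveC70.x⁻¹ β *
      (curveC70.y * curveC70.x⁻¹ ^ 3)))
    (hg0 : g ≠ 0) (h : α.eval 0 + β.eval 0 * b ≠ 0) : v.ord g = -n := by
  rw [hg] at hg0 ⊢
  rw [v.ord_mul (left_ne_zero_of_mul hg0) (right_ne_zero_of_mul hg0), v.ord_pow,
    Place.ord_eq_zero (Place.IsChart.val_eq_one v hv.1 hv.2 h),
    ← inv_inv curveC70.x, v.ord_inv, ord_x_inv hb hv]
  ring

theorem rep_ne_zero {α β N : k[X]}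
    (hN : α ^ 2 - α * β * curveC70.hBar - β ^ 2 * curveC70.fBar = N) (hN0 : N ≠ 0) :
    aeval curveC70.x α + aeval curveC70.x β * curveC70.y ≠ 0 := by
  intro h0
  have h := curveC70.isChart_affine.mul_conj α β
  rw [h0, zero_mul, hN] at h
  exact curveC70.isChart_affine.aeval_ne_zero hN0 h.symm

theorem norm_ne_zero {c : k} (hc : c ≠ 0) (i j : ℕ) : C c * (X - 2) ^ i * (X - 4) ^ j ≠ 0 := by
  have h2 : (X - 2 : k[X]) ≠ 0 := X_sub_C_ne_zero 2
  have h4 : (X - 4 : k[X]) ≠ 0 := X_sub_C_ne_zero 4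
  exact mul_ne_zero (mul_ne_zero (by simpa using hc) (pow_ne_zero _ h2)) (pow_ne_zero _ h4)

theorem hInf_eval : curveC70.hInf.eval 0 = 2 := by
  rw [hInf_eq]; norm_num

theorem hBar_eval_two : curveC70.hBar.eval 2 = 32 := by
  rw [hBar_eq]; norm_num

theorem hBar_eval_four : curveC70.hBar.eval 4 = 26 := by
  rw [hBar_eq]; norm_num

/-! ### Four relations between the six points -/

namespace Points

variable (S : Points)

/-- The function is (-x² + 57x - 396) + (2x² - 15x + 36) y, of norm -1458 (x - 4)⁵; it vanishes at B
but not at B'. -/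
theorem principal_five_B : S.divisor 0 0 5 0 0 (-5) ∈
    Divisor.principal k curveC70.FunctionField := by
  have hx := curveC70.x_ne_zero
  have hc : (-1458 : k) ≠ 0 := by norm_num
  have hN : (-X ^ 2 + 57 * X - 396 : k[X]) ^ 2 -
      (-X ^ 2 + 57 * X - 396) * (2 * X ^ 2 - 15 * X + 36) * curveC70.hBar -
      (2 * X ^ 2 - 15 * X + 36) ^ 2 * curveC70.fBar =
      C (-1458) * (X - 2) ^ 0 * (X - 4) ^ 5 := by
    rw [hBar_eq, fBar_eq]; simp only [map_neg, map_ofNat]; ring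
  have hg0 := rep_ne_zero hN (norm_ne_zero hc _ _)
  have hinf : aeval curveC70.x (-X ^ 2 + 57 * X - 396 : k[X]) +
      aeval curveC70.x (2 * X ^ 2 - 15 * X + 36 : k[X]) * curveC70.y = curveC70.x ^ 5 *
      (aeval curveC70.x⁻¹ (-396 * X ^ 5 + 57 * X ^ 4 - X ^ 3 : k[X]) +
      aeval curveC70.x⁻¹ (36 * X ^ 2 - 15 * X + 2 : k[X]) * (curveC70.y * curveC70.x⁻¹ ^ 3)) := by
    simp only [map_add, map_sub, map_mul, map_neg, map_pow, map_ofNat, aeval_X]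
    field_simp
    ring
  refine S.divisor_mem_principal hg0 ?_ ?_ ?_ ?_ ?_ ?_ fun v h1 h2 h3 =>
    ord_eq_zero_of_norm hc hN h1 h2 h3
  · exact ord_eq_zero S.isAffinePoint_A (by norm_num)
  · exact ord_eq_zero S.isAffinePoint_A' (by norm_num)
  · refine curveC70.isChart_affine.ord_eq (N := C (-1458)) (n := 5) ?_ S.B S.isAffinePoint_B.1
      S.isAffinePoint_B.2 ?_ ?_ ?_
    · rw [hBar_eval_four]; norm_num
    · rw [hBar_eval_four]; norm_num
    · rw [hN, map_ofNat]; ring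
    · rw [eval_C]; exact hc
  · exact ord_eq_zero S.isAffinePoint_B' (by norm_num)
  -- After the factor xⁿ with n = 5 is removed, the norm in z = 1/x is the reversed norm in degree
  -- 2n, so it is divisible by z to the power e = 2·5 - 5. The order at P is e - n = 0. At M the
  -- remaining factor is nonzero and the order is -n. The next two relations follow the same
  -- pattern.
  · refine (ord_infinity (N := -1458 * (1 - 4 * X) ^ 5) (e := 5) ?_ S.isInfinitePoint_P hinf hg0
      ?_ ?_ ?_).trans (by norm_num)
    · rw [hInf_eval]; norm_num
    · rw [hInf_eval]; norm_num
    · rw [hInf_eq, fInf_eq]; ring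
    · norm_num
  · refine (ord_infinity_of_ne_zero ?_ S.isInfinitePoint_M hinf hg0 ?_).trans (by norm_num)
    · rw [hInf_eval]; norm_num
    · norm_num

/-- The function is (53 - x) + (2x - 7) y, of norm -2178 (x - 2)²(x - 4), with zeros at A and B'.
Here n = 4 and e = 8 - 3, which gives a simple zero at P. -/
theorem principal_two_A : S.divisor 2 0 0 1 1 (-4) ∈
    Divisor.principal k curveC70.FunctionField := by
  have hx := curveC70.x_ne_zero
  have hc : (-2178 : k) ≠ 0 := by norm_num
  have hN : (53 - X : k[X]) ^ 2 - (53 - X) * (2 * X - 7) * curveC70.hBar -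
      (2 * X - 7) ^ 2 * curveC70.fBar = C (-2178) * (X - 2) ^ 2 * (X - 4) ^ 1 := by
    rw [hBar_eq, fBar_eq]; simp only [map_neg, map_ofNat]; ring
  have hg0 := rep_ne_zero hN (norm_ne_zero hc _ _)
  have hinf : aeval curveC70.x (53 - X : k[X]) +
      aeval curveC70.x (2 * X - 7 : k[X]) * curveC70.y = curveC70.x ^ 4 *
      (aeval curveC70.x⁻¹ (53 * X ^ 4 - X ^ 3 : k[X]) +
      aeval curveC70.x⁻¹ (2 - 7 * X : k[X]) * (curveC70.y * curveC70.x⁻¹ ^ 3)) := by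
    simp only [map_sub, map_mul, map_pow, map_ofNat, aeval_X]
    field_simp
  refine S.divisor_mem_principal hg0 ?_ ?_ ?_ ?_ ?_ ?_ fun v h1 h2 h3 =>
    ord_eq_zero_of_norm hc hN h1 h2 h3
  · refine curveC70.isChart_affine.ord_eq (N := -2178 * (X - 4)) (n := 2) ?_ S.A
      S.isAffinePoint_A.1 S.isAffinePoint_A.2 ?_ ?_ ?_
    · rw [hBar_eval_two]; norm_num
    · rw [hBar_eval_two]; norm_num
    · rw [hN, map_neg, map_ofNat, map_ofNat]; ring
    · norm_num
  · exact ord_eq_zero S.isAffinePoint_A' (by norm_num)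
  · exact ord_eq_zero S.isAffinePoint_B (by norm_num)
  · refine curveC70.isChart_affine.ord_eq (N := -2178 * (X - 2) ^ 2) (n := 1) ?_ S.B'
      S.isAffinePoint_B'.1 S.isAffinePoint_B'.2 ?_ ?_ ?_
    · rw [hBar_eval_four]; norm_num
    · rw [hBar_eval_four]; norm_num
    · rw [hN, map_neg, map_ofNat, map_ofNat]; ring
    · norm_num
  · refine (ord_infinity (N := -2178 * (1 - 2 * X) ^ 2 * (1 - 4 * X)) (e := 5) ?_
      S.isInfinitePoint_P hinf hg0 ?_ ?_ ?_).trans (by norm_num)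
    · rw [hInf_eval]; norm_num
    · rw [hInf_eval]; norm_num
    · rw [hInf_eq, fInf_eq]; ring
    · norm_num
  · refine (ord_infinity_of_ne_zero ?_ S.isInfinitePoint_M hinf hg0 ?_).trans (by norm_num)
    · rw [hInf_eval]; norm_num
    · norm_num

/-- The function is y + 2x³ - 12x² + 13x - 11, of norm -18 (x - 2)⁴(x - 4), with zeros at A and B.
Its leading terms cancel at M, where y/x³ = -2, so the pole there has order 2 and not 3. -/
theorem principal_four_A : S.divisor 4 0 1 0 (-3) (-2) ∈
    Divisor.principal k curveC70.FunctionField := by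
  have hx := curveC70.x_ne_zero
  have hc : (-18 : k) ≠ 0 := by norm_num
  have hN : (2 * X ^ 3 - 12 * X ^ 2 + 13 * X - 11 : k[X]) ^ 2 -
      (2 * X ^ 3 - 12 * X ^ 2 + 13 * X - 11) * 1 * curveC70.hBar - 1 ^ 2 * curveC70.fBar =
      C (-18) * (X - 2) ^ 4 * (X - 4) ^ 1 := by
    rw [hBar_eq, fBar_eq]; simp only [map_neg, map_ofNat]; ring
  have hg0 := rep_ne_zero hN (norm_ne_zero hc _ _)
  have hinf : aeval curveC70.x (2 * X ^ 3 - 12 * X ^ 2 + 13 * X - 11 : k[X]) +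
      aeval curveC70.x (1 : k[X]) * curveC70.y = curveC70.x ^ 3 *
      (aeval curveC70.x⁻¹ (2 - 12 * X + 13 * X ^ 2 - 11 * X ^ 3 : k[X]) +
      aeval curveC70.x⁻¹ (1 : k[X]) * (curveC70.y * curveC70.x⁻¹ ^ 3)) := by
    simp only [map_add, map_sub, map_mul, map_pow, map_ofNat, map_one, aeval_X]
    field_simp
  refine S.divisor_mem_principal hg0 ?_ ?_ ?_ ?_ ?_ ?_ fun v h1 h2 h3 =>
    ord_eq_zero_of_norm hc hN h1 h2 h3
  · refine curveC70.isChart_affine.ord_eq (N := -18 * (X - 4)) (n := 4) ?_ S.A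
      S.isAffinePoint_A.1 S.isAffinePoint_A.2 ?_ ?_ ?_
    · rw [hBar_eval_two]; norm_num
    · rw [hBar_eval_two]; norm_num
    · rw [hN, map_neg, map_ofNat, map_ofNat]; ring
    · norm_num
  · exact ord_eq_zero S.isAffinePoint_A' (by norm_num)
  · refine curveC70.isChart_affine.ord_eq (N := -18 * (X - 2) ^ 4) (n := 1) ?_ S.B
      S.isAffinePoint_B.1 S.isAffinePoint_B.2 ?_ ?_ ?_
    · rw [hBar_eval_four]; norm_num
    · rw [hBar_eval_four]; norm_num
    · rw [hN, map_neg, map_ofNat, map_ofNat]; ring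
    · norm_num
  · exact ord_eq_zero S.isAffinePoint_B' (by norm_num)
  · refine (ord_infinity_of_ne_zero ?_ S.isInfinitePoint_P hinf hg0 ?_).trans (by norm_num)
    · rw [hInf_eval]; norm_num
    · norm_num
  · refine (ord_infinity (N := -18 * (1 - 2 * X) ^ 4 * (1 - 4 * X)) (e := 1) ?_
      S.isInfinitePoint_M hinf hg0 ?_ ?_ ?_).trans (by norm_num)
    · rw [hInf_eval]; norm_num
    · rw [hInf_eval]; norm_num
    · rw [hInf_eq, fInf_eq]; ring
    · norm_num

theorem ord_infinity_x_sub {v : curveC70.Point} {b : k} (hb : 2 * b + curveC70.hInf.eval 0 ≠ 0)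
    (hv : curveC70.IsInfinitePoint v b) (a : k) :
    v.ord (curveC70.x - algebraMap k curveC70.FunctionField a) = -1 := by
  have hx := curveC70.x_ne_zero
  refine (ord_infinity_of_ne_zero (α := 1 - C a * X) (β := 0) (n := 1) hb hv ?_
    (curveC70.isChart_affine.sub_ne_zero a) (by simp)).trans (by norm_num)
  simp only [map_sub, map_mul, map_one, map_zero, aeval_X, aeval_C]
  field_simp
  ring

/-- This is the divisor of x - 4. -/
theorem principal_B_add_conj : S.divisor 0 0 1 1 (-1) (-1) ∈
    Divisor.principal k curveC70.FunctionField := by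
  refine S.divisor_mem_principal (curveC70.isChart_affine.sub_ne_zero 4) ?_ ?_ ?_ ?_ ?_ ?_
    fun v _ _ h3 => Place.ord_eq_zero h3
  · have h := ord_eq_zero S.isAffinePoint_A (α := X - C 4) (β := 0) (by norm_num)
    rwa [map_zero, zero_mul, add_zero, map_sub, aeval_X, aeval_C] at h
  · have h := ord_eq_zero S.isAffinePoint_A' (α := X - C 4) (β := 0) (by norm_num)
    rwa [map_zero, zero_mul, add_zero, map_sub, aeval_X, aeval_C] at h
  · exact curveC70.isChart_affine.ord_sub_eq (by rw [hBar_eval_four]; norm_num) S.B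
      S.isAffinePoint_B.1 S.isAffinePoint_B.2
  · exact curveC70.isChart_affine.ord_sub_eq (by rw [hBar_eval_four]; norm_num) S.B'
      S.isAffinePoint_B'.1 S.isAffinePoint_B'.2
  · exact ord_infinity_x_sub (by rw [hInf_eval]; norm_num) S.isInfinitePoint_P 4
  · exact ord_infinity_x_sub (by rw [hInf_eval]; norm_num) S.isInfinitePoint_M 4

/-! ### Nonprincipal divisors and the order of the class -/

theorem conj_A : curveC70.conj S.A = S.A' := by
  have h := curveC70.isAffinePoint_conj S.isAffinePoint_A
  refine eq_of_isAffinePoint (b := -49) (by rw [hBar_eval_two]; norm_num) ?_ S.isAffinePoint_A'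
  convert h using 1
  rw [hBar_eval_two]; norm_num

theorem conj_B : curveC70.conj S.B = S.B' := by
  have h := curveC70.isAffinePoint_conj S.isAffinePoint_B
  refine eq_of_isAffinePoint (b := -49) (by rw [hBar_eval_four]; norm_num) ?_ S.isAffinePoint_B'
  convert h using 1
  rw [hBar_eval_four]; norm_num

/-- The sign conditions make a principal divisor of this shape symmetric, and the involution
exchanges A with A' and B with B'. -/
theorem divisor_notMem_principal {a a' b b' p m : ℤ} (ha : 0 ≤ a) (ha' : 0 ≤ a') (hb : 0 ≤ b)
    (hb' : 0 ≤ b') (hp : -2 ≤ p) (hm : -2 ≤ m) (hne : a ≠ a' ∨ b ≠ b') :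
    S.divisor a a' b b' p m ∉ Divisor.principal k curveC70.FunctionField := by
  intro h
  have key := curveC70.apply_conj_of_mem_principal natDegree_disc ⟨S.P, S.isAtInfinity_P⟩ h
    (fun v hv => ?_) (fun v hv => ?_)
  · rcases hne with hne | hne
    · have := key S.A
      rw [conj_A, divisor_apply_A, divisor_apply_A'] at this
      exact hne this.symm
    · have := key S.B
      rw [conj_B, divisor_apply_B, divisor_apply_B'] at this
      exact hne this.symm
  · by_cases h1 : v = S.A
    · rwa [h1, divisor_apply_A]
    by_cases h2 : v = S.A'
    · rwa [h2, divisor_apply_A']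
    by_cases h3 : v = S.B
    · rwa [h3, divisor_apply_B]
    by_cases h4 : v = S.B'
    · rwa [h4, divisor_apply_B']
    rw [S.isAtInfinity_iff] at hv
    rw [S.divisor_apply_of_ne _ _ _ _ _ _ h1 h2 h3 h4 (by tauto) (by tauto)]
  · rcases (S.isAtInfinity_iff v).1 hv with rfl | rfl
    · rwa [divisor_apply_P]
    · rwa [divisor_apply_M]

theorem mk_divisor (a a' b b' p m : ℤ) :
    (QuotientAddGroup.mk (S.divisor a a' b b' p m) : curveC70.DivisorClassGroup) =
      a • curveC70.pointClass S.A + a' • curveC70.pointClass S.A' + b • curveC70.pointClass S.B +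
        b' • curveC70.pointClass S.B' + p • curveC70.pointClass S.P +
        m • curveC70.pointClass S.M := by
  have h : ∀ (P : curveC70.Point) (n : ℤ),
      (Finsupp.single P n : Divisor k curveC70.FunctionField) = n • Finsupp.single P 1 := by
    intro P n
    rw [Finsupp.smul_single, smul_eq_mul, mul_one]
  rw [divisor, h S.A, h S.A', h S.B, h S.B', h S.P, h S.M]
  rfl

/-- The class of `A + B - P - M`. -/
noncomputable def torsionClass : curveC70.DivisorClassGroup :=
  QuotientAddGroup.mk (Finsupp.single S.A 1 + Finsupp.single S.B 1 - Finsupp.single S.P 1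
    - Finsupp.single S.M 1)

theorem torsionClass_eq : S.torsionClass = curveC70.pointClass S.A + curveC70.pointClass S.B -
    curveC70.pointClass S.P - curveC70.pointClass S.M := rfl

theorem mk_divisor_eq_zero {a a' b b' p m : ℤ}
    (h : S.divisor a a' b b' p m ∈ Divisor.principal k curveC70.FunctionField) :
    a • curveC70.pointClass S.A + a' • curveC70.pointClass S.A' + b • curveC70.pointClass S.B +
      b' • curveC70.pointClass S.B' + p • curveC70.pointClass S.P +
        m • curveC70.pointClass S.M = 0 := by
  rw [← mk_divisor]
  exact (QuotientAddGroup.eq_zero_iff _).2 h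

theorem mk_divisor_ne_zero {a a' b b' p m : ℤ}
    (h : S.divisor a a' b b' p m ∉ Divisor.principal k curveC70.FunctionField) :
    a • curveC70.pointClass S.A + a' • curveC70.pointClass S.A' + b • curveC70.pointClass S.B +
      b' • curveC70.pointClass S.B' + p • curveC70.pointClass S.P +
        m • curveC70.pointClass S.M ≠ 0 := by
  rw [← mk_divisor]
  exact mt (QuotientAddGroup.eq_zero_iff _).1 h

theorem addOrderOf_torsionClass : addOrderOf S.torsionClass = 70 := by
  have r1 := S.mk_divisor_eq_zero S.principal_five_B
  have r2 := S.mk_divisor_eq_zero S.principal_two_A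
  have r3 := S.mk_divisor_eq_zero S.principal_four_A
  have r4 := S.mk_divisor_eq_zero S.principal_B_add_conj
  refine addOrderOf_eq_of_nsmul_and_div_prime_nsmul (by norm_num) ?_ fun q hq hdvd hzero => ?_
  · rw [torsionClass_eq]
    -- The coefficients solve the integer linear system that expresses 70 (A + B - P - M) through
    -- the four relations.
    linear_combination (norm := module) (9 : ℤ) • r1 - (5 : ℤ) • r2 + (20 : ℤ) • r3 + (5 : ℤ) • r4
  · have hq' : q = 2 ∨ q = 5 ∨ q = 7 := by
      have h : q ∈ Nat.primeFactors 70 := Nat.mem_primeFactors.2 ⟨hq, hdvd, by norm_num⟩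
      rw [show (70 : ℕ) = 2 * (5 * 7) from rfl, Nat.primeFactors_mul (by norm_num) (by norm_num),
        Nat.primeFactors_mul (by norm_num) (by norm_num), Nat.Prime.primeFactors (by norm_num),
        Nat.Prime.primeFactors (by norm_num), Nat.Prime.primeFactors (by norm_num)] at h
      simp at h
      tauto
    rw [torsionClass_eq] at hzero
    rcases hq' with rfl | rfl | rfl
    -- 35 D is equivalent to A + 3B' - 2P - 2M, which is not symmetric.
    · replace hzero : 35 • (curveC70.pointClass S.A + curveC70.pointClass S.B -
        curveC70.pointClass S.P - curveC70.pointClass S.M) = 0 := hzero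
      refine S.mk_divisor_ne_zero (S.divisor_notMem_principal (a := 1) (a' := 0) (b := 0) (b' := 3)
        (p := -2) (m := -2) (by norm_num) (by norm_num)
        (by norm_num) (by norm_num) (by norm_num) (by norm_num) (by norm_num)) ?_
      linear_combination (norm := module) hzero - (5 : ℤ) • r1 + (3 : ℤ) • r2 - (10 : ℤ) • r3
    -- It suffices that a multiple of 14 D is nonzero: 4 · 14 D is equivalent to B - M, a
    -- representative small enough for the criterion.
    · replace hzero : 14 • (curveC70.pointClass S.A + curveC70.pointClass S.B -
        curveC70.pointClass S.P - curveC70.pointClass S.M) = 0 := hzero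
      refine S.mk_divisor_ne_zero (S.divisor_notMem_principal (a := 0) (a' := 0) (b := 1) (b' := 0)
        (p := 0) (m := -1) (by norm_num) (by norm_num)
        (by norm_num) (by norm_num) (by norm_num) (by norm_num) (by norm_num)) ?_
      linear_combination (norm := module) (4 : ℤ) • hzero - (7 : ℤ) • r1 + (4 : ℤ) • r2 -
        (16 : ℤ) • r3 - (4 : ℤ) • r4
    -- Likewise 4 · 10 D is equivalent to 2A + B - P - 2M.
    · replace hzero : 10 • (curveC70.pointClass S.A + curveC70.pointClass S.B -
        curveC70.pointClass S.P - curveC70.pointClass S.M) = 0 := hzero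
      refine S.mk_divisor_ne_zero (S.divisor_notMem_principal (a := 2) (a' := 0) (b := 1) (b' := 0)
        (p := -1) (m := -2) (by norm_num) (by norm_num)
        (by norm_num) (by norm_num) (by norm_num) (by norm_num) (by norm_num)) ?_
      linear_combination (norm := module) (4 : ℤ) • hzero - (5 : ℤ) • r1 + (3 : ℤ) • r2 -
        (11 : ℤ) • r3 - (3 : ℤ) • r4

end Points

/-! ### Rationality of the class -/

theorem eq_of_isInfinitePoint {b : k} (hb : 2 * b + curveC70.hInf.eval 0 ≠ 0)
    {u v : curveC70.Point} (hu : curveC70.IsInfinitePoint u b)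
    (hv : curveC70.IsInfinitePoint v b) : u = v :=
  curveC70.isChart_infinity.unique hb hu.1 hu.2 hv.1 hv.2

/-- Each of the four points is itself Galois stable: its image has the same rational coordinates,
and only one place has them. -/
theorem Points.torsionClass_mem (S : Points) :
    S.torsionClass ∈ curveC70.jacobianRationalPoints := by
  rw [mem_jacobianRationalPoints]
  refine ⟨⟨_, ?_, rfl⟩, fun σ => ?_⟩
  · change Divisor.degree _ _ _ = 0
    rw [map_sub, map_sub, map_add]
    simp [Divisor.degree]
  · have hσ : ∀ q : ℚ, σ (algebraMap ℚ _ q) = algebraMap ℚ _ q := σ.commutes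
    have hA : curveC70.galoisPoint σ S.A = S.A :=
      eq_of_isAffinePoint (by rw [hBar_eval_two]; norm_num)
        (curveC70.isAffinePoint_galoisPoint σ (by simpa using hσ 2) (by simpa using hσ 17)
        S.isAffinePoint_A)
        S.isAffinePoint_A
    have hB : curveC70.galoisPoint σ S.B = S.B :=
      eq_of_isAffinePoint (by rw [hBar_eval_four]; norm_num)
        (curveC70.isAffinePoint_galoisPoint σ (by simpa using hσ 4) (by simpa using hσ 23)
        S.isAffinePoint_B)
        S.isAffinePoint_B
    have hP : curveC70.galoisPoint σ S.P = S.P :=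
      eq_of_isInfinitePoint (by rw [hInf_eval]; norm_num)
        (curveC70.isInfinitePoint_galoisPoint σ (by simp) S.isInfinitePoint_P)
        S.isInfinitePoint_P
    have hM : curveC70.galoisPoint σ S.M = S.M :=
      eq_of_isInfinitePoint (by rw [hInf_eval]; norm_num)
        (curveC70.isInfinitePoint_galoisPoint σ (by simpa using hσ (-2))
        S.isInfinitePoint_M)
        S.isInfinitePoint_M
    rw [Points.torsionClass_eq, map_sub, map_sub, map_add, galoisClass_pointClass,
      galoisClass_pointClass, galoisClass_pointClass, galoisClass_pointClass, hA, hB, hP, hM]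

end CurveC70

end

theorem mainTheorem1 :
    (∃ P : curveC70.jacobianRationalPoints, addOrderOf P = 70) ∧
    (∃ Q₁ Q₂ P₁ P₂ : curveC70.Point,
      curveC70.IsAffinePoint Q₁ 2 17 ∧ curveC70.IsAffinePoint Q₂ 4 23 ∧
      P₁ ≠ P₂ ∧ (∀ P : curveC70.Point, curveC70.IsAtInfinity P ↔ P = P₁ ∨ P = P₂) ∧
      ∃ P : curveC70.jacobianRationalPoints, addOrderOf P = 70 ∧
        (P : curveC70.DivisorClassGroup) = QuotientAddGroup.mk
          (Finsupp.single Q₁ 1 + Finsupp.single Q₂ 1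
            - Finsupp.single P₁ 1 - Finsupp.single P₂ 1)) := by
  obtain ⟨S⟩ := CurveC70.nonempty_points
  have h : addOrderOf (⟨S.torsionClass, S.torsionClass_mem⟩ : curveC70.jacobianRationalPoints) =
      70 := by
    rw [← AddSubgroup.addOrderOf_coe]
    exact S.addOrderOf_torsionClass
  exact ⟨⟨_, h⟩, S.A, S.B, S.P, S.M, S.isAffinePoint_A, S.isAffinePoint_B, S.P_ne_M,
    S.isAtInfinity_iff, _, h, rfl⟩
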